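/- **Setting.** Let $\Omega\subset\mathbb R^2$ be a bounded polygonal domain (connected, possibly with holes, with $\operatorname{int}\overline\Omega=\Omega$), whose boundary is $\partial\Omega=\overline\Gamma_c\cup\overline\Gamma_s\cup\overline\Gamma_f$ with pairwise disjoint relatively open parts. Let $E,d>0$, $\nu\in[0,\tfrac12)$, $\mathbb M\tau=\frac{Ed^3}{12(1-\nu^2)}\big((1-\nu)\tau+\nu\,\mathrm{tr}(\tau)\delta\big)$ for symmetric $2\times2$ matrices ($\delta$ the identity), and $f\in L^2(\Omega)$. Put $\widetilde U=\{v\in H^2(\Omega): v=0\text{ on }\Gamma_c\cup\Gamma_s,\ \partial_nv=0\text{ on }\Gamma_c\}$, let $u\in\widetilde U$ satisfy $\int_\Omega\mathbb M\nabla^2u:\nabla^2v=\int_\Omega fv$ for all $v\in\widetilde U$ (the weak solution of $\mathrm{div}\,\mathbf{div}\,\mathbb M\nabla^2u=f$ with clamped, simply supported and free conditions on $\Gamma_c,\Gamma_s,\Gamma_f$), and put $\sigma=\mathbb M\nabla^2u$. Let $\mathcal T_h$ be a conforming triangulation of $\overline\Omega$ such that the relative interior of every edge lies in $\Omega$, $\Gamma_c$,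 $\Gamma_s$ or $\Gamma_f$, and whose shape regularity is bounded by $\kappa$ (every $T\in\mathcal T_h$ contains a disc of some diameter $\rho>0$ with $\mathrm{diam}\,T\le\kappa\rho$). Let $h_T=\mathrm{area}(T)^{1/2}$, let $h_e$ be the length of an edge $e$, and let $\Gamma_h^c$ be the set of the edges that are interior or lie on $\Gamma_c$. On an interior edge $[\![\partial_n w]\!]$ is the jump of $\partial_n w$ across the edge, and on a boundary edge it is $\partial_nw$. Write $\|\cdot\|_T$, $\|\cdot\|_e$ for $L^2$ norms and $\nabla_h^2$ for the piecewise Hessian. Let $r\ge1$. For $m\ge 1$ let $S_h^m=\{v\in H^1(\Omega): v|_T\in\mathcal P_m(T)\ \forall T\in\mathcal T_h\}$ and $U_h^m=\{v\in S_h^m: v=0\text{ on }\Gamma_c\cup\Gamma_s\}$. Let $\Sigma_h$ be the space of symmetric $2\times2$ matrix fields $\tau$ with $\tau|_T\in\mathcal P_{r-1}(T)^{2\times2}$ for all $T$, for which $\tau_{nn}=n^{\mathsf T}\tau n$ is single-valued on interior edges and zero on the edges in $\Gamma_s\cup\Gamma_f$. With $b_h(\tau,v)=-(\tau,\nabla_h^2v)+\sum_{T}\langle\tau_{nn},\partial_nv\rangle_{\partial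 T}$, let $(\sigma_h,u_h)\in\Sigma_h\times U_h^r$ be a Hellan–Herrmann–Johnson solution: $$(\mathbb M^{-1}\sigma_h,\tau_h)+b_h(\tau_h,u_h)=0\quad\forall\tau_h\in\Sigma_h,\qquad b_h(\sigma_h,v_h)=-(f,v_h)\quad\forall v_h\in U_h^r .$$ Let $I_h^r v\in S_h^r$ denote the interpolant of a continuous $v$ that has the same values at the vertices, the same moments against $\mathcal P_{r-2}(e)$ on each edge and the same moments against $\mathcal P_{r-3}(T)$ on each triangle (polynomial spaces of negative degree are $\{0\}$), and let $W_h=(I-I_h^r)U_h^{r+1}$. Let $u_h^*=u_h+w_h$, where $w_h\in W_h$ satisfies $(\mathbb M\nabla_h^2w_h,\nabla_h^2v_h)=(\sigma_h-\mathbb M\nabla_h^2u_h,\nabla_h^2v_h)$ for all $v_h\in W_h$. Let $Q_h^r$ be the $L^2$ projection onto discontinuous piecewise polynomials of degree at most $r$. Define $$\eta_h(T)=\Big(\|\mathbb M^{-1}\sigma_h-\nabla_h^2u_h^*\|_T^2+h_T^4\|f-\mathrm{div}\,\mathbf{div}\,\sigma_h\|_T^2+\sum_{e\subset\partial T,\ e\in\Gamma_h^c}h_e^{-1}\|[\![\partial_nu_h^*]\!]\|_e^2\Big)^{1/2},$$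 $$\|w\|_{2,h,T}=\Big(\|\nabla^2w\|_T^2+\sum_{e\subset\partial T,\ e\in\Gamma_h^c}h_e^{-1}\|[\![\partial_nw]\!]\|_e^2\Big)^{1/2}.$$ **Theorem (local efficiency).** There is a constant $C>0$ that depends only on $\Omega$, $E$, $d$, $r$ and $\kappa$ (not on $\nu$, the splitting of $\partial\Omega$, $f$, $u$, the triangulation or the discrete solution) such that, for each $T\in\mathcal T_h$, $$\eta_h(T)\le C\Big(\|\sigma-\sigma_h\|_T+\|u-u_h^*\|_{2,h,T}+h_T^2\|f-Q_h^rf\|_T\Big).$$ -/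

import Mathlib

open MeasureTheory
open scoped ContDiff

/-! ### The plane, test functions, Sobolev functions -/

/-- The Euclidean plane. -/
abbrev E2 : Type := EuclideanSpace ℝ (Fin 2)

/-- `∂_i φ (x)`, the classical partial derivative. -/
noncomputable def partialD (i : Fin 2) (φ : E2 → ℝ) (x : E2) : ℝ :=
  fderiv ℝ φ x (EuclideanSpace.single i 1)

/-- Smooth functions with compact support in the whole plane. -/
def IsTest (φ : E2 → ℝ) : Prop := ContDiff ℝ ∞ φ ∧ HasCompactSupport φ

/-- `g` is the weak partial derivative `∂_i v` on the open set `Ω`. -/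
def IsWeakPartial (Ω : Set E2) (i : Fin 2) (v g : E2 → ℝ) : Prop :=
  ∀ φ : E2 → ℝ, IsTest φ → tsupport φ ⊆ Ω →
    ∫ x in Ω, v x * partialD i φ x = - ∫ x in Ω, g x * φ x

/-- `v ∈ H¹(Ω)` with weak gradient `Dv`. -/
def IsH1 (Ω : Set E2) (v : E2 → ℝ) (Dv : Fin 2 → E2 → ℝ) : Prop :=
  MemLp v 2 (volume.restrict Ω) ∧
    ∀ i, MemLp (Dv i) 2 (volume.restrict Ω) ∧ IsWeakPartial Ω i v (Dv i)

/-- `v ∈ H²(Ω)` with weak gradient `Dv` and weak Hessian `D2v`; `D2v i j = ∂_j ∂_i v`. -/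
def IsH2 (Ω : Set E2) (v : E2 → ℝ) (Dv : Fin 2 → E2 → ℝ) (D2v : Fin 2 → Fin 2 → E2 → ℝ) :
    Prop :=
  IsH1 Ω v Dv ∧ ∀ i, IsH1 Ω (Dv i) (D2v i)

/-- `v = 0` on the relatively open part `Γ` of the boundary, in the sense of traces of `H¹(Ω)`:
the boundary term `∫_{∂Ω} v φ n_i` of Green's formula is zero for all smooth `φ` that vanish near
the rest of the boundary. -/
def VanishesOn (Ω Γ : Set E2) (v : E2 → ℝ) (Dv : Fin 2 → E2 → ℝ) : Prop :=
  ∀ i : Fin 2, ∀ φ : E2 → ℝ, IsTest φ → Disjoint (tsupport φ) (frontier Ω \ Γ) →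
    ∫ x in Ω, (v x * partialD i φ x + Dv i x * φ x) = 0

/-- `∂_n v = 0` on the relatively open part `Γ` of the boundary, in the sense of (normal) traces:
the boundary term `∫_{∂Ω} (∂_n v) φ` of Green's formula for `∇v` is zero for all smooth `φ` that
vanish near the rest of the boundary. -/
def NormalDerivVanishesOn (Ω Γ : Set E2) (Dv : Fin 2 → E2 → ℝ)
    (D2v : Fin 2 → Fin 2 → E2 → ℝ) : Prop :=
  ∀ φ : E2 → ℝ, IsTest φ → Disjoint (tsupport φ) (frontier Ω \ Γ) →
    ∫ x in Ω, ((∑ i, D2v i i x) * φ x + ∑ i, Dv i x * partialD i φ x) = 0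

/-! ### The plate problem -/

/-- The Frobenius product `A : B`. -/
def frob (A B : Matrix (Fin 2) (Fin 2) ℝ) : ℝ := ∑ i, ∑ j, A i j * B i j

/-- The linear moment operator `𝕄` (Young modulus `Ey`, thickness `d`, Poisson ratio `ν`). -/
noncomputable def moment (Ey d ν : ℝ) (A : Matrix (Fin 2) (Fin 2) ℝ) :
    Matrix (Fin 2) (Fin 2) ℝ :=
  (Ey * d ^ 3 / (12 * (1 - ν ^ 2))) • ((1 - ν) • A + (ν * A.trace) • (1 : Matrix _ _ ℝ))

/-- The inverse `𝕄⁻¹` of the moment operator. -/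
noncomputable def momentInv (Ey d ν : ℝ) (A : Matrix (Fin 2) (Fin 2) ℝ) :
    Matrix (Fin 2) (Fin 2) ℝ :=
  (12 / (Ey * d ^ 3)) • ((1 + ν) • A - (ν * A.trace) • (1 : Matrix _ _ ℝ))

theorem moment_momentInv {Ey d ν : ℝ} (hE : 0 < Ey) (hd : 0 < d) (h0 : 0 ≤ ν) (h1 : ν < 1 / 2)
    (A : Matrix (Fin 2) (Fin 2) ℝ) :
    moment Ey d ν (momentInv Ey d ν A) = A ∧ momentInv Ey d ν (moment Ey d ν A) = A := by
  have h2 : (1 - ν ^ 2) ≠ 0 := by nlinarith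
  constructor <;> ext i j <;> fin_cases i <;> fin_cases j <;>
    simp [moment, momentInv, Matrix.trace, Fin.sum_univ_two] <;> field_simp <;> ring

/-- The matrix of values at `x` of a matrix of functions. -/
def matAt (S : Fin 2 → Fin 2 → E2 → ℝ) (x : E2) : Matrix (Fin 2) (Fin 2) ℝ :=
  Matrix.of fun i j => S i j x

/-- Bounded planar domain. The last condition, which every Lipschitz domain satisfies, says that
the domain does not lie on both sides of its boundary. -/
structure IsPlateDomain (Ω : Set E2) : Prop where
  isOpen : IsOpen Ω
  isConnected : IsConnected Ω
  isBounded : Bornology.IsBounded Ω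
  interior_closure : interior (closure Ω) = Ω

/-- `∂Ω` is made of relatively open, pairwise disjoint parts: clamped, simply supported, free. -/
structure IsBoundarySplitting (Ω Γc Γs Γf : Set E2) : Prop where
  open_c : ∃ V : Set E2, IsOpen V ∧ Γc = V ∩ frontier Ω
  open_s : ∃ V : Set E2, IsOpen V ∧ Γs = V ∩ frontier Ω
  open_f : ∃ V : Set E2, IsOpen V ∧ Γf = V ∩ frontier Ω
  disj_cs : Disjoint Γc Γs
  disj_cf : Disjoint Γc Γf
  disj_sf : Disjoint Γs Γf
  cover : frontier Ω = closure Γc ∪ closure Γs ∪ closure Γf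

/-- The energy space: `v ∈ H²(Ω)`, `v = 0` on `Γc ∪ Γs`, `∂_n v = 0` on `Γc`. -/
def IsEnergyFn (Ω Γc Γs : Set E2) (v : E2 → ℝ) (Dv : Fin 2 → E2 → ℝ)
    (D2v : Fin 2 → Fin 2 → E2 → ℝ) : Prop :=
  IsH2 Ω v Dv D2v ∧ VanishesOn Ω (Γc ∪ Γs) v Dv ∧ NormalDerivVanishesOn Ω Γc Dv D2v

/-- `u` (with weak gradient `Du` and weak Hessian `D2u`) is the weak solution of
`div div 𝕄∇²u = f` in `Ω`, with `u = ∂_n u = 0` on `Γc`, `u = σ_nn = 0` on `Γs` and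
`σ_nn = K(σ) = 0` on the rest of the boundary, where `σ = 𝕄∇²u`. -/
def IsPlateSolution (Ω Γc Γs : Set E2) (Ey d ν : ℝ) (f : E2 → ℝ)
    (u : E2 → ℝ) (Du : Fin 2 → E2 → ℝ) (D2u : Fin 2 → Fin 2 → E2 → ℝ) : Prop :=
  IsEnergyFn Ω Γc Γs u Du D2u ∧
    ∀ (v : E2 → ℝ) (Dv : Fin 2 → E2 → ℝ) (D2v : Fin 2 → Fin 2 → E2 → ℝ),
      IsEnergyFn Ω Γc Γs v Dv D2v →
        ∫ x in Ω, frob (moment Ey d ν (matAt D2u x)) (matAt D2v x) = ∫ x in Ω, f x * v x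

/-! ### Triangulations -/

/-- The closed simplex with the given vertices. -/
def hull (s : Finset E2) : Set E2 := convexHull ℝ (s : Set E2)

/-- An edge without its end points. -/
def openEdge (e : Finset E2) : Set E2 := hull e \ (e : Set E2)

/-- A conforming triangulation of `closure Ω` (a triangle is the set of its three vertices). -/
structure Mesh (Ω : Set E2) where
  tri : Finset (Finset E2)
  card_tri : ∀ T ∈ tri, T.card = 3
  indep : ∀ T ∈ tri, AffineIndependent ℝ ((↑) : T → E2)
  conforming : ∀ T ∈ tri, ∀ T' ∈ tri, hull T ∩ hull T' = convexHull ℝ ((T : Set E2) ∩ T')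
  cover : (⋃ T ∈ tri, hull T) = closure Ω

/-- The three edges of a triangle. -/
def triEdges (T : Finset E2) : Finset (Finset E2) := T.powersetCard 2

namespace Mesh

variable {Ω : Set E2}

/-- `e` is an edge of the mesh. -/
def IsEdge (K : Mesh Ω) (e : Finset E2) : Prop := ∃ T ∈ K.tri, e ∈ triEdges T

/-- Each edge is an interior edge, or lies on one of the three parts of the boundary. -/
def Resolves (K : Mesh Ω) (Γc Γs Γf : Set E2) : Prop :=
  ∀ e, K.IsEdge e →
    openEdge e ⊆ Ω ∨ openEdge e ⊆ Γc ∨ openEdge e ⊆ Γs ∨ openEdge e ⊆ Γf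

/-- Shape regularity: the ratio of the diameter of each triangle to the diameter `ρ` of some disc
contained in it is at most `κ`. -/
def ShapeRegular (K : Mesh Ω) (κ : ℝ) : Prop :=
  ∀ T ∈ K.tri, ∃ (x : E2) (ρ : ℝ), 0 < ρ ∧ Metric.closedBall x (ρ / 2) ⊆ hull T ∧
    Metric.diam (hull T) ≤ κ * ρ

end Mesh

/-- `h_T`, the square root of the area. -/
noncomputable def meshSize (T : Finset E2) : ℝ := Real.sqrt (volume (hull T)).toReal

/-- `h_e`, the length of an edge. -/
noncomputable def edgeLen (e : Finset E2) : ℝ := Metric.diam (hull e)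

/-- Arc length on an edge. -/
noncomputable def edgeMeasure (e : Finset E2) : Measure E2 :=
  (Measure.hausdorffMeasure 1).restrict (hull e)

open Classical in
/-- The edges of `T` that are interior or clamped. -/
noncomputable def jumpEdges (Ω Γc : Set E2) (T : Finset E2) : Finset (Finset E2) :=
  {e ∈ triEdges T | openEdge e ⊆ Ω ∨ openEdge e ⊆ Γc}

/-- The outward unit normal of the triangle `T` on its edge `e`. -/
noncomputable def outNormal (T e : Finset E2) : E2 :=
  Classical.epsilon fun n : E2 =>
    ‖n‖ = 1 ∧ (∀ a ∈ e, ∀ b ∈ e, inner ℝ n (b - a) = 0) ∧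
      ∀ a ∈ e, ∀ c ∈ T, c ∉ e → inner ℝ n (c - a) < 0

/-! ### Piecewise polynomials -/

/-- A real polynomial in the two coordinates. -/
abbrev Poly2 : Type := MvPolynomial (Fin 2) ℝ

/-- The value of a polynomial at a point of the plane. -/
noncomputable def pval (p : Poly2) (x : E2) : ℝ := MvPolynomial.eval (fun i => x i) p

/-- The Hessian of a polynomial, as a matrix of functions. -/
noncomputable def hessP (p : Poly2) (i j : Fin 2) (x : E2) : ℝ :=
  pval (MvPolynomial.pderiv j (MvPolynomial.pderiv i p)) x

/-- A scalar piecewise polynomial: one polynomial for each triangle. -/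
abbrev PW : Type := Finset E2 → Poly2

/-- A matrix-valued piecewise polynomial. -/
abbrev PWMat : Type := Finset E2 → Fin 2 → Fin 2 → Poly2

/-- The value at `x` of the polynomial matrix on `T`. -/
noncomputable def matP (τ : PWMat) (T : Finset E2) (x : E2) : Matrix (Fin 2) (Fin 2) ℝ :=
  Matrix.of fun i j => pval (τ T i j) x

/-- `n · ∇v` on the edge `e`, from inside the triangle `T`, `n` the outward normal of `T`. -/
noncomputable def normalDerivP (v : PW) (T e : Finset E2) (x : E2) : ℝ :=
  ∑ i, outNormal T e i * pval (MvPolynomial.pderiv i (v T)) x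

/-- `τ_nn = nᵀ τ n` on the edge `e`, from inside the triangle `T`. -/
noncomputable def nnP (τ : PWMat) (T e : Finset E2) (x : E2) : ℝ :=
  ∑ i, ∑ j, outNormal T e i * matP τ T x i j * outNormal T e j

/-- `div div τ` on the triangle `T`. -/
noncomputable def divDivP (τ : PWMat) (T : Finset E2) (x : E2) : ℝ :=
  ∑ i, ∑ j, pval (MvPolynomial.pderiv i (MvPolynomial.pderiv j (τ T i j))) x

namespace Mesh

variable {Ω : Set E2}

open Classical in
/-- The function on `Ω` given by a piecewise polynomial (its value on the edges, a null set, is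
immaterial). -/
noncomputable def glue (K : Mesh Ω) (v : PW) (x : E2) : ℝ :=
  ∑ T ∈ K.tri, if x ∈ interior (hull T) then pval (v T) x else 0

/-- `S_h^m`: piecewise polynomials of degree at most `m` that belong to `H¹(Ω)`. -/
def MemS (K : Mesh Ω) (m : ℕ) (v : PW) : Prop :=
  (∀ T ∈ K.tri, (v T).totalDegree ≤ m) ∧ ∃ Dv, IsH1 Ω (K.glue v) Dv

/-- `U_h^m`: the functions in `S_h^m` that vanish on `Γc ∪ Γs`. -/
def MemU (K : Mesh Ω) (Γc Γs : Set E2) (m : ℕ) (v : PW) : Prop :=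
  K.MemS m v ∧ ∃ Dv, IsH1 Ω (K.glue v) Dv ∧ VanishesOn Ω (Γc ∪ Γs) (K.glue v) Dv

/-- `Σ_h`: symmetric piecewise polynomial matrices of degree at most `r - 1` whose normal-normal
component is single-valued on interior edges and zero on `Γs ∪ Γf`. -/
def MemSigma (K : Mesh Ω) (Γs Γf : Set E2) (r : ℕ) (τ : PWMat) : Prop :=
  (∀ T ∈ K.tri, ∀ i j, τ T i j = τ T j i ∧ (τ T i j).totalDegree ≤ r - 1) ∧
  (∀ T ∈ K.tri, ∀ T' ∈ K.tri, ∀ e ∈ triEdges T, e ∈ triEdges T' → openEdge e ⊆ Ω →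
    ∀ x ∈ hull e, nnP τ T e x = nnP τ T' e x) ∧
  (∀ T ∈ K.tri, ∀ e ∈ triEdges T, openEdge e ⊆ Γs ∨ openEdge e ⊆ Γf →
    ∀ x ∈ hull e, nnP τ T e x = 0)

/-- The bilinear form `a(σ, τ) = (𝕄⁻¹ σ, τ)`. -/
noncomputable def formA (K : Mesh Ω) (Ey d ν : ℝ) (σ τ : PWMat) : ℝ :=
  ∑ T ∈ K.tri, ∫ x in hull T, frob (momentInv Ey d ν (matP σ T x)) (matP τ T x)

/-- The bilinear form `b_h(τ, v) = -(τ, ∇_h² v) + ∑_T ⟨τ_nn, ∂_n v⟩_{∂T}`. -/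
noncomputable def formB (K : Mesh Ω) (τ : PWMat) (v : PW) : ℝ :=
  ∑ T ∈ K.tri, (- (∫ x in hull T, frob (matP τ T x) (matAt (hessP (v T)) x)) +
    ∑ e ∈ triEdges T, ∫ x, nnP τ T e x * normalDerivP v T e x ∂(edgeMeasure e))

/-- The Hellan--Herrmann--Johnson method: `(σh, uh) ∈ Σ_h × U_h^r` is a discrete solution. -/
def IsHHJSolution (K : Mesh Ω) (Γc Γs Γf : Set E2) (Ey d ν : ℝ) (r : ℕ) (f : E2 → ℝ)
    (σh : PWMat) (uh : PW) : Prop :=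
  K.MemSigma Γs Γf r σh ∧ K.MemU Γc Γs r uh ∧
  (∀ τ, K.MemSigma Γs Γf r τ → K.formA Ey d ν σh τ + K.formB τ uh = 0) ∧
  (∀ v, K.MemU Γc Γs r v → K.formB σh v = - ∫ x in Ω, f x * K.glue v x)

/-- `w = I_h^r v`, the modified Lagrange interpolant in `S_h^r`: equal values at the vertices,
equal moments of degree at most `r - 2` on edges and at most `r - 3` on triangles (no condition
if that degree is negative). -/
def IsInterpolant (K : Mesh Ω) (r : ℕ) (v w : PW) : Prop :=
  K.MemS r w ∧ ∀ T ∈ K.tri,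
    (∀ z ∈ T, pval (w T) z = pval (v T) z) ∧
    (∀ e ∈ triEdges T, ∀ q : Poly2, q.totalDegree + 2 ≤ r →
      ∫ x, pval (w T) x * pval q x ∂(edgeMeasure e) =
        ∫ x, pval (v T) x * pval q x ∂(edgeMeasure e)) ∧
    (∀ q : Poly2, q.totalDegree + 3 ≤ r →
      ∫ x in hull T, pval (w T) x * pval q x = ∫ x in hull T, pval (v T) x * pval q x)

/-- The bubble space `W_h = (I - I_h^r) U_h^{r+1}`. -/
def MemW (K : Mesh Ω) (Γc Γs : Set E2) (r : ℕ) (w : PW) : Prop :=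
  ∃ v Iv : PW, K.MemU Γc Γs (r + 1) v ∧ K.IsInterpolant r v Iv ∧ ∀ T ∈ K.tri, w T = v T - Iv T

/-- `wh ∈ W_h` solves
`(𝕄 ∇_h² wh, ∇_h² v) = (σh - 𝕄 ∇_h² uh, ∇_h² v)` for all `v ∈ W_h`. -/
def IsCorrection (K : Mesh Ω) (Γc Γs : Set E2) (Ey d ν : ℝ) (r : ℕ) (σh : PWMat) (uh wh : PW) :
    Prop :=
  K.MemW Γc Γs r wh ∧ ∀ v, K.MemW Γc Γs r v →
    ∑ T ∈ K.tri, ∫ x in hull T,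
        frob (moment Ey d ν (matAt (hessP (wh T)) x)) (matAt (hessP (v T)) x) =
      ∑ T ∈ K.tri, ∫ x in hull T,
        frob (matP σh T x - moment Ey d ν (matAt (hessP (uh T)) x)) (matAt (hessP (v T)) x)

/-- `q = Q_h^r f`, the `L²` projection onto discontinuous piecewise polynomials of degree at most
`r`. -/
def IsL2Projection (K : Mesh Ω) (r : ℕ) (f : E2 → ℝ) (q : PW) : Prop :=
  ∀ T ∈ K.tri, (q T).totalDegree ≤ r ∧ ∀ p : Poly2, p.totalDegree ≤ r →
    ∫ x in hull T, pval (q T) x * pval p x = ∫ x in hull T, f x * pval p x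

/-! ### Jumps, the discrete `H²` norm, the estimator -/

open Classical in
/-- The jump `⟦∂_n v⟧` on the edge `e` of a piecewise polynomial `v`, written as the sum of the
outward normal derivatives from the triangles that contain `e`. On an interior edge this is the
difference of the two one-sided values of `∂_{n_e} v`, up to the sign fixed by the orientation of
`n_e`, on which norms do not depend; on a boundary edge it is `∂_n v`. -/
noncomputable def jumpP (K : Mesh Ω) (v : PW) (e : Finset E2) (x : E2) : ℝ :=
  ∑ T ∈ K.tri with e ∈ triEdges T, normalDerivP v T e x

/-- `J ∈ L²(e)` is the jump `⟦∂_n w⟧` (with the same sign convention) on the edge `e` of a piecewise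
`H²` function `w`, given by its gradient `Dw T` and Hessian `D2w T` on each triangle `T`. The
normal trace is understood through Green's formula on the triangles,
`∑_T ∫_T (Δw φ + ∇w · ∇φ) = ∫_e ⟦∂_n w⟧ φ`
for all smooth `φ` that vanish near all other edges. -/
def IsNormalJump (K : Mesh Ω) (Dw : Finset E2 → Fin 2 → E2 → ℝ)
    (D2w : Finset E2 → Fin 2 → Fin 2 → E2 → ℝ) (e : Finset E2) (J : E2 → ℝ) : Prop :=
  MemLp J 2 (edgeMeasure e) ∧
  ∀ φ : E2 → ℝ, IsTest φ →
    (∀ e', K.IsEdge e' → e' ≠ e → Disjoint (tsupport φ) (hull e')) →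
      ∑ T ∈ K.tri, ∫ x in hull T,
          ((∑ i, D2w T i i x) * φ x + ∑ i, Dw T i x * partialD i φ x) =
        ∫ x, J x * φ x ∂(edgeMeasure e)

open Classical in
/-- The jump `⟦∂_n w⟧` on `e` of a piecewise `H²` function; it is unique almost everywhere. -/
noncomputable def normalJump (K : Mesh Ω) (Dw : Finset E2 → Fin 2 → E2 → ℝ)
    (D2w : Finset E2 → Fin 2 → Fin 2 → E2 → ℝ) (e : Finset E2) : E2 → ℝ :=
  if h : ∃ J, K.IsNormalJump Dw D2w e J then h.choose else 0

/-- The local mesh-dependent norm `‖w‖_{2,h,T}` of a piecewise `H²` function. -/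
noncomputable def norm2h (K : Mesh Ω) (Γc : Set E2) (Dw : Finset E2 → Fin 2 → E2 → ℝ)
    (D2w : Finset E2 → Fin 2 → Fin 2 → E2 → ℝ) (T : Finset E2) : ℝ :=
  Real.sqrt ((∫ x in hull T, frob (matAt (D2w T) x) (matAt (D2w T) x)) +
    ∑ e ∈ jumpEdges Ω Γc T,
      (edgeLen e)⁻¹ * ∫ x, (K.normalJump Dw D2w e x) ^ 2 ∂(edgeMeasure e))

/-- `‖u - v‖_{2,h,T}` for `u ∈ H²(Ω)` and a piecewise polynomial `v`. -/
noncomputable def deflectionError (K : Mesh Ω) (Γc : Set E2) (Du : Fin 2 → E2 → ℝ)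
    (D2u : Fin 2 → Fin 2 → E2 → ℝ) (v : PW) (T : Finset E2) : ℝ :=
  K.norm2h Γc (fun T' i x => Du i x - pval (MvPolynomial.pderiv i (v T')) x)
    (fun T' i j x => D2u i j x - hessP (v T') i j x) T

/-- The error indicator `η_h(T)`. -/
noncomputable def estimator (K : Mesh Ω) (Γc : Set E2) (Ey d ν : ℝ) (f : E2 → ℝ)
    (σh : PWMat) (us : PW) (T : Finset E2) : ℝ :=
  Real.sqrt
    ((∫ x in hull T, frob (momentInv Ey d ν (matP σh T x) - matAt (hessP (us T)) x)
        (momentInv Ey d ν (matP σh T x) - matAt (hessP (us T)) x)) +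
      meshSize T ^ 4 * (∫ x in hull T, (f x - divDivP σh T x) ^ 2) +
      ∑ e ∈ jumpEdges Ω Γc T, (edgeLen e)⁻¹ * ∫ x, (K.jumpP us e x) ^ 2 ∂(edgeMeasure e))

end Mesh

/-- The local moment error `‖σ - σh‖_T`, `σ = 𝕄∇²u`. -/
noncomputable def momentError (Ey d ν : ℝ) (D2u : Fin 2 → Fin 2 → E2 → ℝ) (σh : PWMat)
    (T : Finset E2) : ℝ :=
  Real.sqrt (∫ x in hull T, frob (moment Ey d ν (matAt D2u x) - matP σh T x)
    (moment Ey d ν (matAt D2u x) - matP σh T x))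

/-!
The consistency residual splits as `𝕄⁻¹σₕ - ∇²uₕ* = ∇²(u - uₕ*) - 𝕄⁻¹(σ - σₕ)`, and `𝕄⁻¹` is
bounded by `18 / (E d³)` uniformly in `ν`. The jump of `∂ₙu` vanishes on every edge of `Γₕᶜ`, so the
jumps of `uₕ*` are, up to sign, those of `u - uₕ*`.

For the interior residual, let `b` be the cubic bubble of a triangle `T`, put
`p = Qf - div div σₕ` and `v = b² p`. Both `v` and `∇v` vanish on `∂T`, so `v` extended by zero is
an admissible test function for `u`, and integrating `σₕ : ∇²v` by parts over `T` leaves no boundary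
terms: `∫ p v = ∫ (Qf - f) v + ∫ (σ - σₕ) : ∇²v`. On the finite-dimensional space of polynomials of
degree at most `r` all norms are equivalent, so pulling back to the reference triangle gives
`‖p‖² ≲ ∫ p v`, `‖v‖ ≲ ‖p‖` and `‖∇²v‖ ≲ h_T⁻² ‖p‖`.
-/

/-! ### Triangles and their affine parametrization -/

theorem ext_E2 {x y : E2} (h0 : x 0 = y 0) (h1 : x 1 = y 1) : x = y := by
  ext i; fin_cases i <;> assumption

theorem inner_E2 (x y : E2) : inner ℝ x y = x 0 * y 0 + x 1 * y 1 := by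
  simp [PiLp.inner_apply, Fin.sum_univ_two, mul_comm]

/-- The determinant of two vectors of the plane. -/
def det2 (y z : E2) : ℝ := y 0 * z 1 - y 1 * z 0

/-- The reference triangle, with the vertices `(0, 0)`, `(1, 0)` and `(0, 1)`. -/
def refTri : Set E2 := {s | 0 ≤ s 0 ∧ 0 ≤ s 1 ∧ s 0 + s 1 ≤ 1}

/-- The affine parametrization of the triangle `a b c` by the reference triangle. -/
noncomputable def triPt (a b c s : E2) : E2 := a + s 0 • (b - a) + s 1 • (c - a)

/-- The barycentric coordinates of `x` with respect to `b` and `c`: the inverse of `triPt a b c`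
(for a degenerate triangle, where `det2 (b - a) (c - a) = 0`, the value is `0`). -/
noncomputable def bary (a b c x : E2) : E2 :=
  (det2 (b - a) (c - a))⁻¹ • !₂[det2 (x - a) (c - a), det2 (b - a) (x - a)]

theorem bary_triPt {a b c : E2} (h : det2 (b - a) (c - a) ≠ 0) (s : E2) :
    bary a b c (triPt a b c s) = s := by
  rw [bary, inv_smul_eq_iff₀ h]
  apply ext_E2 <;> simp [triPt, det2] <;> ring

theorem triPt_bary {a b c : E2} (h : det2 (b - a) (c - a) ≠ 0) (x : E2) :
    triPt a b c (bary a b c x) = x := by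
  apply ext_E2 <;> simp [triPt, bary] <;> field_simp <;> simp [det2] <;> ring

theorem continuous_triPt (a b c : E2) : Continuous (triPt a b c) := by
  unfold triPt; fun_prop

theorem continuous_bary (a b c : E2) : Continuous (bary a b c) := by
  unfold bary det2; fun_prop

theorem convex_refTri : Convex ℝ refTri := by
  rintro s ⟨hs0, hs1, hs2⟩ t ⟨ht0, ht1, ht2⟩ x y hx hy hxy
  refine ⟨?_, ?_, ?_⟩ <;> simp <;> nlinarith

theorem convexHull_eq_image_refTri (a b c : E2) :
    convexHull ℝ ({a, b, c} : Set E2) = triPt a b c '' refTri := by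
  apply Set.Subset.antisymm
  · apply convexHull_min
    · rintro x (rfl | rfl | rfl)
      · exact ⟨0, by simp [refTri], by simp [triPt]⟩
      · exact ⟨!₂[1, 0], by simp [refTri], by simp [triPt]⟩
      · exact ⟨!₂[0, 1], by simp [refTri], by simp [triPt]⟩
    · rintro _ ⟨s, hs, rfl⟩ _ ⟨t, ht, rfl⟩ x y hx hy hxy
      refine ⟨x • s + y • t, convex_refTri hs ht hx hy hxy, ?_⟩
      obtain rfl : x = 1 - y := by linarith
      apply ext_E2 <;> simp [triPt] <;> ring
  · rintro _ ⟨s, ⟨h0, h1, h2⟩, rfl⟩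
    have := (convex_convexHull ℝ ({a, b, c} : Set E2)).sum_mem (t := Finset.univ)
      (w := ![1 - s 0 - s 1, s 0, s 1]) (z := ![a, b, c])
      (by intro i _; fin_cases i <;> simp <;> linarith)
      (by simp [Fin.sum_univ_three]; ring)
      (by intro i _; apply subset_convexHull; fin_cases i <;> simp)
    convert this using 1
    apply ext_E2 <;> simp [Fin.sum_univ_three, triPt] <;> ring

theorem convexHull_eq_preimage_refTri {a b c : E2} (h : det2 (b - a) (c - a) ≠ 0) :
    convexHull ℝ ({a, b, c} : Set E2) = bary a b c ⁻¹' refTri := by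
  rw [convexHull_eq_image_refTri]
  exact congr_fun (Set.image_eq_preimage_of_inverse (bary_triPt h) (triPt_bary h)) _

theorem refTri_eq_convexHull : refTri = convexHull ℝ {0, !₂[1, 0], !₂[0, 1]} := by
  rw [convexHull_eq_image_refTri, Set.image_congr (g := id), Set.image_id]
  intro s _
  apply ext_E2 <;> simp [triPt]

theorem isCompact_refTri : IsCompact refTri := by
  rw [refTri_eq_convexHull]
  exact Set.Finite.isCompact_convexHull ℝ (by simp)

theorem integral_triangle {a b c : E2} (h : det2 (b - a) (c - a) ≠ 0) (g : E2 → ℝ) :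
    ∫ x in convexHull ℝ ({a, b, c} : Set E2), g x =
      |det2 (b - a) (c - a)| * ∫ s in refTri, g (triPt a b c s) := by
  set L : E2 →L[ℝ] E2 := (EuclideanSpace.proj 0).smulRight (b - a) +
    (EuclideanSpace.proj 1).smulRight (c - a) with hL
  have hdet : L.det = det2 (b - a) (c - a) := by
    rw [ContinuousLinearMap.det, ← LinearMap.det_toMatrix (EuclideanSpace.basisFun _ ℝ).toBasis,
      Matrix.det_fin_two]
    simp [LinearMap.toMatrix_apply, hL, det2]
    ring
  have hder (s : E2) : HasFDerivAt (triPt a b c) L s := by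
    have : triPt a b c = fun s => a + L s := by
      funext s; simp [triPt, hL, add_assoc]
    rw [this]
    exact L.hasFDerivAt.const_add _
  rw [convexHull_eq_image_refTri, integral_image_eq_integral_abs_det_fderiv_smul volume
    isCompact_refTri.measurableSet (fun s _ => (hder s).hasFDerivWithinAt)
    (Function.LeftInverse.injective (bary_triPt h)).injOn]
  simp_rw [hdet, smul_eq_mul, integral_const_mul]

theorem integral_refTri {g : E2 → ℝ} (hg : Continuous g) :
    ∫ s in refTri, g s = ∫ t in (0 : ℝ)..1, ∫ s in (0 : ℝ)..(1 - t), g !₂[s, t] := by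
  set m : ℝ × ℝ ≃ᵐ E2 :=
    (MeasurableEquiv.finTwoArrow (α := ℝ)).symm.trans (MeasurableEquiv.toLp 2 (Fin 2 → ℝ))
  have hm_apply (p : ℝ × ℝ) : m p = !₂[p.1, p.2] := rfl
  have hmp : MeasurePreserving m :=
    (PiLp.volume_preserving_toLp (Fin 2)).comp ((volume_preserving_finTwoArrow ℝ).symm _)
  have hslice (s t : ℝ) : refTri.indicator g !₂[s, t] =
      (Set.Icc 0 1).indicator
        (fun t => (Set.Icc 0 (1 - t)).indicator (fun s => g !₂[s, t]) s) t := by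
    simp only [Set.indicator_apply, refTri, Set.mem_ofPred_eq, Set.mem_Icc, Matrix.cons_val_zero,
      Matrix.cons_val_one]
    split_ifs <;> first | rfl | grind
  have hint : Integrable (refTri.indicator g) :=
    (hg.continuousOn.integrableOn_compact isCompact_refTri).integrable_indicator
      isCompact_refTri.measurableSet
  have hint' := (hmp.integrable_comp_emb m.measurableEmbedding).2 hint
  rw [← integral_indicator isCompact_refTri.measurableSet,
    ← hmp.integral_comp m.measurableEmbedding, Measure.volume_eq_prod,
    integral_prod_symm _ (by rwa [← Measure.volume_eq_prod]),
    intervalIntegral.integral_of_le zero_le_one, ← integral_Icc_eq_integral_Ioc,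
    ← integral_indicator measurableSet_Icc]
  congr 1 with t
  simp only [hm_apply, hslice]
  by_cases ht : t ∈ Set.Icc (0 : ℝ) 1
  · simp only [Set.indicator_of_mem ht]
    rw [integral_indicator measurableSet_Icc, integral_Icc_eq_integral_Ioc,
      intervalIntegral.integral_of_le (by linarith [ht.2])]
  · simp only [Set.indicator_of_notMem ht, integral_zero]

theorem integral_fderiv_triangle {a b c : E2} (h : det2 (b - a) (c - a) ≠ 0) {g : E2 → ℝ}
    (hg : ContDiff ℝ 1 g) :
    ∫ x in convexHull ℝ ({a, b, c} : Set E2), fderiv ℝ g x (b - a) =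
      |det2 (b - a) (c - a)| *
        ((∫ t in (0 : ℝ)..1, g (b + t • (c - b))) - ∫ t in (0 : ℝ)..1, g (a + t • (c - a))) := by
  have hc : Continuous fun x => fderiv ℝ g x (b - a) :=
    (hg.continuous_fderiv one_ne_zero).clm_apply continuous_const
  have hslice (s t : ℝ) : HasDerivAt (fun s : ℝ => g (triPt a b c !₂[s, t]))
      (fderiv ℝ g (triPt a b c !₂[s, t]) (b - a)) s := by
    have : HasDerivAt (fun s : ℝ => triPt a b c !₂[s, t]) (b - a) s := by
      simpa [triPt] using
        (((hasDerivAt_id s).smul_const (b - a)).const_add a).add_const (t • (c - a))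
    exact (hg.differentiable one_ne_zero _).hasFDerivAt.comp_hasDerivAt s this
  have hside (y w : E2) : IntervalIntegrable (fun t : ℝ => g (y + t • w)) volume 0 1 :=
    Continuous.intervalIntegrable (hg.continuous.comp (by fun_prop)) _ _
  rw [integral_triangle h,
    integral_refTri (g := fun s => fderiv ℝ g (triPt a b c s) (b - a))
      (hc.comp (continuous_triPt a b c)),
    ← intervalIntegral.integral_sub (hside _ _) (hside _ _)]
  congr 1
  apply intervalIntegral.integral_congr
  intro t _
  dsimp only
  rw [intervalIntegral.integral_eq_sub_of_hasDerivAt (fun s _ => hslice s t)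
    (Continuous.intervalIntegrable
      (hc.comp ((continuous_triPt a b c).comp (by fun_prop))) _ _)]
  congr 2 <;> apply ext_E2 <;> simp [triPt] <;> ring

/-! ### Vertices and edges of a triangle -/

theorem isCompact_hull (s : Finset E2) : IsCompact (hull s) :=
  s.finite_toSet.isCompact_convexHull ℝ

theorem measurableSet_hull (s : Finset E2) : MeasurableSet (hull s) :=
  (isCompact_hull s).measurableSet

theorem hull_mono {s t : Finset E2} (h : s ⊆ t) : hull s ⊆ hull t :=
  convexHull_mono (Finset.coe_subset.2 h)

theorem integrableOn_hull_of_continuous {g : E2 → ℝ} (hg : Continuous g) (T : Finset E2) :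
    IntegrableOn g (hull T) :=
  hg.continuousOn.integrableOn_compact (isCompact_hull T)

theorem hull_pair {e : Finset E2} {p q : E2} (he : (e : Set E2) = {p, q}) :
    hull e = segment ℝ p q := by
  rw [hull, he, convexHull_pair]

theorem exists_pair_of_mem_triEdges {T e : Finset E2} (he : e ∈ triEdges T) :
    ∃ p q, p ≠ q ∧ (e : Set E2) = {p, q} := by
  classical
  obtain ⟨p, q, hpq, rfl⟩ := Finset.card_eq_two.1 (Finset.mem_powersetCard.1 he).2
  exact ⟨p, q, hpq, by simp⟩

theorem subset_of_mem_triEdges {T e : Finset E2} (he : e ∈ triEdges T) : e ⊆ T :=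
  (Finset.mem_powersetCard.1 he).1

/-- `T` is a nondegenerate triangle with the vertices `a`, `b`, `c`. -/
structure IsTriangle (T : Finset E2) (a b c : E2) : Prop where
  coe_eq : (T : Set E2) = {a, b, c}
  det_ne : det2 (b - a) (c - a) ≠ 0

namespace IsTriangle

variable {T e : Finset E2} {a b c : E2}

theorem swap (h : IsTriangle T a b c) : IsTriangle T a c b where
  coe_eq := by rw [h.coe_eq, Set.pair_comm]
  det_ne := by
    have := h.det_ne
    contrapose! this
    unfold det2 at *; linarith

theorem rotate (h : IsTriangle T a b c) : IsTriangle T b c a where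
  coe_eq := by rw [h.coe_eq, Set.insert_comm, Set.pair_comm a c, Set.insert_comm, Set.insert_comm]
  det_ne := by
    have := h.det_ne
    contrapose! this
    unfold det2 at *; simp at *; linarith

theorem hull_eq (h : IsTriangle T a b c) : hull T = convexHull ℝ {a, b, c} := by
  rw [hull, h.coe_eq]

theorem ne_fst (h : IsTriangle T a b c) : a ≠ b := by
  rintro rfl; exact h.det_ne (by simp [det2])

theorem ne_snd (h : IsTriangle T a b c) : b ≠ c := h.rotate.ne_fst

theorem ne_trd (h : IsTriangle T a b c) : a ≠ c := h.swap.ne_fst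

open scoped Classical in
theorem eq (h : IsTriangle T a b c) : T = {a, b, c} := by
  rw [← Finset.coe_inj, h.coe_eq]; simp

open scoped Classical in
theorem triEdges_eq (h : IsTriangle T a b c) :
    triEdges T = {({a, b} : Finset E2), {a, c}, {b, c}} := by
  have hab := h.ne_fst
  have hbc := h.ne_snd
  have hac := h.ne_trd
  rw [triEdges, h.eq, Finset.powersetCard_succ_insert (by simp [hab, hac]),
    Finset.powersetCard_succ_insert (by simpa using hbc)]
  simp only [Finset.powersetCard_one, Finset.map_singleton, Finset.map_insert]
  ext e
  simp only [Function.Embedding.coeFn_mk, Finset.image_singleton, Finset.union_singleton,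
    Finset.image_insert, Finset.union_insert, Finset.mem_insert,
    Finset.mem_powersetCard, Finset.subset_singleton_iff, Finset.mem_singleton]
  grind

open scoped Classical in
theorem sum_triEdges (h : IsTriangle T a b c) (F : Finset E2 → ℝ) :
    ∑ e ∈ triEdges T, F e = F {a, b} + F {a, c} + F {b, c} := by
  have hab := h.ne_fst
  have hbc := h.ne_snd
  have hac := h.ne_trd
  rw [h.triEdges_eq, Finset.sum_insert, Finset.sum_insert, Finset.sum_singleton, add_assoc]
  all_goals
    simp only [Finset.mem_insert, Finset.mem_singleton, ← Finset.coe_inj, Finset.coe_pair,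
      Set.pair_eq_pair_iff]
    grind

theorem exists_opposite (h : IsTriangle T a b c) (he : e ∈ triEdges T) :
    ∃ o p q, IsTriangle T o p q ∧ (e : Set E2) = {p, q} := by
  classical
  rw [h.triEdges_eq] at he
  simp only [Finset.mem_insert, Finset.mem_singleton] at he
  rcases he with rfl | rfl | rfl
  · exact ⟨c, a, b, h.rotate.rotate, by simp⟩
  · exact ⟨b, a, c, h.rotate.swap, by simp⟩
  · exact ⟨a, b, c, h, by simp⟩

end IsTriangle

theorem det2_ne_zero_of_affineIndependent {a b c : E2} (h : AffineIndependent ℝ ![a, b, c]) :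
    det2 (b - a) (c - a) ≠ 0 := by
  have hlin : LinearIndependent ℝ ![b - a, c - a] := by
    have hcomp : ![b - a, c - a] = (fun i : {i : Fin 3 // i ≠ 0} => ![a, b, c] i -ᵥ a) ∘
        finSuccAboveEquiv 0 := by
      ext i : 1
      fin_cases i <;> rfl
    rw [hcomp, linearIndependent_equiv]
    exact (affineIndependent_iff_linearIndependent_vsub ℝ _ 0).1 h
  rw [LinearIndependent.pair_iff] at hlin
  intro hdet
  obtain ⟨-, h0⟩ := hlin ((c - a) 0) (-(b - a) 0)
    (by unfold det2 at hdet; apply ext_E2 <;> simp at hdet ⊢ <;> linarith)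
  obtain ⟨-, h1⟩ := hlin ((c - a) 1) (-(b - a) 1)
    (by unfold det2 at hdet; apply ext_E2 <;> simp at hdet ⊢ <;> linarith)
  have hba : b - a = 0 := ext_E2 (neg_eq_zero.1 h0) (neg_eq_zero.1 h1)
  simpa using (hlin 1 0 (by simp [hba])).1

theorem exists_isTriangle {T : Finset E2} (h3 : T.card = 3)
    (hT : AffineIndependent ℝ ((↑) : T → E2)) : ∃ a b c, IsTriangle T a b c := by
  classical
  obtain ⟨a, b, c, hab, hac, hbc, rfl⟩ := Finset.card_eq_three.1 h3
  refine ⟨a, b, c, by simp, det2_ne_zero_of_affineIndependent ?_⟩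
  let vertices : Fin 3 ↪ ({a, b, c} : Finset E2) :=
    ⟨![⟨a, by simp⟩, ⟨b, by simp⟩, ⟨c, by simp⟩], by
      intro i j hij; fin_cases i <;> fin_cases j <;> simp_all⟩
  convert hT.comp_embedding vertices using 1
  ext i : 1
  fin_cases i <;> rfl

theorem Mesh.exists_isTriangle {Ω : Set E2} (K : Mesh Ω) {T : Finset E2} (hT : T ∈ K.tri) :
    ∃ a b c, IsTriangle T a b c :=
  _root_.exists_isTriangle (K.card_tri T hT) (K.indep T hT)

/-! ### Integration along an edge -/

/-- The mean value of `g` over the segment from `p` to `q`. -/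
noncomputable def segMean (g : E2 → ℝ) (p q : E2) : ℝ := ∫ t in (0 : ℝ)..1, g (p + t • (q - p))

theorem isometry_add_smul (p : E2) {w : E2} (hw : ‖w‖ = 1) : Isometry fun t : ℝ => p + t • w :=
  Isometry.of_dist_eq fun s t => by
    rw [dist_add_left, dist_eq_norm, ← sub_smul, norm_smul, hw, mul_one, dist_eq_norm]

theorem hausdorffMeasure_restrict_segment {p w : E2} (hw : ‖w‖ = 1) {l : ℝ} (hl : 0 ≤ l) :
    (Measure.hausdorffMeasure 1).restrict (segment ℝ p (p + l • w)) =
      Measure.map (fun t : ℝ => p + t • w) (volume.restrict (Set.Icc 0 l)) := by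
  set γ : ℝ → E2 := fun t => p + t • w with hγ
  have hiso : Isometry γ := isometry_add_smul p hw
  have himage : segment ℝ p (p + l • w) = γ '' Set.Icc 0 l := by
    have : Set.Icc 0 l = (fun t : ℝ => t * l) '' Set.Icc 0 1 := by
      rw [Set.image_mul_right_Icc zero_le_one hl, zero_mul, one_mul]
    rw [segment_eq_image', this, Set.image_image]
    simp [hγ, mul_smul]
  have hemb := hiso.isClosedEmbedding.measurableEmbedding
  have hmap := hiso.map_hausdorffMeasure (d := 1) (Or.inl zero_le_one)
  rw [← hausdorffMeasure_real, himage,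
    ← Set.inter_eq_left.2 (Set.image_subset_range γ (Set.Icc 0 l)),
    ← Measure.restrict_restrict' hiso.isClosedEmbedding.isClosed_range.measurableSet, ← hmap,
    hemb.restrict_map, Set.preimage_image_eq _ hemb.injective]

theorem integral_edgeMeasure {e : Finset E2} {p q : E2} (he : (e : Set E2) = {p, q})
    (hpq : p ≠ q) (g : E2 → ℝ) : ∫ x, g x ∂(edgeMeasure e) = ‖q - p‖ * segMean g p q := by
  have hn : ‖q - p‖ ≠ 0 := norm_ne_zero_iff.2 (sub_ne_zero.2 hpq.symm)
  set w := ‖q - p‖⁻¹ • (q - p) with hw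
  have hw1 : ‖w‖ = 1 := by rw [hw, norm_smul, norm_inv, norm_norm, inv_mul_cancel₀ hn]
  have hq : q = p + ‖q - p‖ • w := by rw [hw, smul_inv_smul₀ hn]; abel
  have hemb := (isometry_add_smul p hw1).isClosedEmbedding.measurableEmbedding
  have hscale := intervalIntegral.mul_integral_comp_mul_left (a := 0) (b := 1)
    (f := fun t : ℝ => g (p + t • w)) (c := ‖q - p‖)
  simp only [mul_zero, mul_one] at hscale
  rw [edgeMeasure, hull_pair he, hq, hausdorffMeasure_restrict_segment hw1 (norm_nonneg _), ← hq,
    hemb.integral_map, integral_Icc_eq_integral_Ioc,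
    ← intervalIntegral.integral_of_le (norm_nonneg _), ← hscale, segMean]
  simp_rw [mul_comm ‖q - p‖ _, mul_smul, hw, smul_inv_smul₀ hn]

theorem isFiniteMeasure_edgeMeasure {T e : Finset E2} (he : e ∈ triEdges T) :
    IsFiniteMeasure (edgeMeasure e) := by
  obtain ⟨p, q, -, h⟩ := exists_pair_of_mem_triEdges he
  constructor
  rw [edgeMeasure, Measure.restrict_apply_univ, hull_pair h, hausdorffMeasure_segment]
  exact edist_lt_top p q

theorem memLp_edgeMeasure_of_continuous {T e : Finset E2} (he : e ∈ triEdges T) {g : E2 → ℝ}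
    (hg : Continuous g) : MemLp g 2 (edgeMeasure e) := by
  have := isFiniteMeasure_edgeMeasure he
  obtain ⟨C, hC⟩ := (isCompact_hull e).exists_bound_of_continuousOn hg.continuousOn
  apply MemLp.of_bound hg.aestronglyMeasurable C
  exact (ae_restrict_iff' (measurableSet_hull e)).2 (Filter.Eventually.of_forall hC)

theorem integrable_edgeMeasure_of_continuous {T e : Finset E2} (he : e ∈ triEdges T) {g : E2 → ℝ}
    (hg : Continuous g) : Integrable g (edgeMeasure e) := by
  have := isFiniteMeasure_edgeMeasure he
  exact (memLp_edgeMeasure_of_continuous he hg).integrable (by norm_num)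

theorem ae_mem_openEdge (e : Finset E2) : ∀ᵐ x ∂(edgeMeasure e), x ∈ openEdge e := by
  have hvertices : (Measure.hausdorffMeasure 1 : Measure E2) (e : Set E2) = 0 := by
    have := Measure.nullSingletonClass_hausdorff E2 (d := 1) one_pos
    exact e.finite_toSet.measure_zero _
  rw [edgeMeasure, ae_restrict_iff' (measurableSet_hull e)]
  filter_upwards [measure_eq_zero_iff_ae_notMem.1 hvertices] with x hx hxe
  exact ⟨hxe, hx⟩

/-! ### The divergence theorem on a triangle -/

theorem IsTriangle.exists_outNormal {T e : Finset E2} {o p q : E2} (hT : IsTriangle T o p q)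
    (he : (e : Set E2) = {p, q}) :
    ∃ n : E2, ‖n‖ = 1 ∧ (∀ a ∈ e, ∀ b ∈ e, inner ℝ n (b - a) = 0) ∧
      ∀ a ∈ e, ∀ c ∈ T, c ∉ e → inner ℝ n (c - a) < 0 := by
  have hmem (x : E2) : x ∈ e ↔ x = p ∨ x = q := by rw [← Finset.mem_coe, he]; simp
  have hmemT (x : E2) : x ∈ T ↔ x = o ∨ x = p ∨ x = q := by
    rw [← Finset.mem_coe, hT.coe_eq]; simp
  set D := det2 (p - o) (q - o) with hD
  have hD0 : D ≠ 0 := hT.det_ne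
  -- the side `q - p` turned by a right angle and oriented by the sign of `D`
  set n : E2 := D • !₂[(q - p) 1, -(q - p) 0] with hn
  have hinner (x : E2) : inner ℝ n x = -(D * det2 (q - p) x) := by
    rw [inner_E2, det2]; simp [hn]; ring
  have hpo (a : E2) (ha : a = p ∨ a = q) : inner ℝ n (o - a) = -D ^ 2 := by
    rw [hinner]; rcases ha with rfl | rfl <;> simp [hD, det2] <;> ring
  have hn0 : n ≠ 0 := by
    intro h
    have := hpo p (Or.inl rfl)
    rw [h, inner_zero_left] at this
    exact hD0 (by simpa using this.symm)
  refine ⟨‖n‖⁻¹ • n, ?_, fun a ha b hb => ?_, fun a ha c hc hce => ?_⟩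
  · rw [norm_smul, norm_inv, norm_norm, inv_mul_cancel₀ (norm_ne_zero_iff.2 hn0)]
  · rw [hmem] at ha hb
    have hparallel : det2 (q - p) (b - a) = 0 := by
      rcases ha with rfl | rfl <;> rcases hb with rfl | rfl <;> simp [det2] <;> ring
    rw [real_inner_smul_left, hinner, hparallel, mul_zero, neg_zero, mul_zero]
  · rw [hmem] at ha hce
    obtain rfl : c = o := by rw [hmemT] at hc; tauto
    rw [real_inner_smul_left, hpo a ha, mul_neg, neg_lt_zero]
    positivity

theorem IsTriangle.outNormal_spec {T e : Finset E2} {o p q : E2} (hT : IsTriangle T o p q)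
    (he : (e : Set E2) = {p, q}) :
    ‖outNormal T e‖ = 1 ∧ inner ℝ (outNormal T e) (q - p) = 0 ∧
      0 < inner ℝ (outNormal T e) (p - o) := by
  have hp : p ∈ e := by rw [← Finset.mem_coe, he]; simp
  have hq : q ∈ e := by rw [← Finset.mem_coe, he]; simp
  have ho : o ∉ e := by rw [← Finset.mem_coe, he]; simp [hT.ne_fst, hT.ne_trd]
  have hoT : o ∈ T := by rw [← Finset.mem_coe, hT.coe_eq]; simp
  have hspec := Classical.epsilon_spec (hT.exists_outNormal he)
  refine ⟨hspec.1, hspec.2.1 p hp q hq, ?_⟩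
  rw [← neg_sub, inner_neg_right]
  exact neg_pos.2 (hspec.2.2 p hp o hoT ho)

theorem IsTriangle.norm_mul_inner_outNormal {T e : Finset E2} {o p q : E2}
    (hT : IsTriangle T o p q) (he : (e : Set E2) = {p, q}) :
    ‖q - p‖ * inner ℝ (outNormal T e) (p - o) = |det2 (p - o) (q - o)| := by
  obtain ⟨hn, hperp, hpos⟩ := hT.outNormal_spec he
  set n := outNormal T e
  have hn' : n 0 ^ 2 + n 1 ^ 2 = 1 := by
    have := real_inner_self_eq_norm_sq n
    rw [hn, inner_E2] at this
    linarith
  have hdet : det2 (p - o) (q - o) = inner ℝ n (p - o) * det2 n (q - p) := by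
    rw [inner_E2] at hperp ⊢
    simp only [det2, PiLp.sub_apply] at *
    linear_combination (-((p 0 - o 0) * (q 1 - p 1) - (p 1 - o 1) * (q 0 - p 0))) * hn' -
      (n 0 * (p 1 - o 1) - n 1 * (p 0 - o 0)) * hperp
  have hnorm : ‖q - p‖ = |det2 n (q - p)| := by
    rw [← abs_norm, ← sq_eq_sq_iff_abs_eq_abs, ← real_inner_self_eq_norm_sq]
    rw [inner_E2] at hperp ⊢
    rw [det2]
    linear_combination (-((q - p) 0 ^ 2 + (q - p) 1 ^ 2)) * hn' +
      (n 0 * (q - p) 0 + n 1 * (q - p) 1) * hperp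
  rw [hdet, hnorm, abs_mul, abs_of_pos hpos, mul_comm]

theorem IsTriangle.integral_fderiv_side {T : Finset E2} {a b c : E2} (hT : IsTriangle T a b c)
    {g : E2 → ℝ} (hg : ContDiff ℝ 1 g) :
    ∫ x in hull T, fderiv ℝ g x (b - a) =
      ∑ e ∈ triEdges T, inner ℝ (outNormal T e) (b - a) * ∫ x, g x ∂(edgeMeasure e) := by
  classical
  have hab : inner ℝ (outNormal T {a, b}) (b - a) = 0 :=
    (hT.rotate.rotate.outNormal_spec (by simp)).2.1
  have hac : ‖c - a‖ * inner ℝ (outNormal T {a, c}) (b - a) = -|det2 (b - a) (c - a)| := by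
    rw [← neg_sub a b, inner_neg_right, mul_neg,
      hT.rotate.swap.norm_mul_inner_outNormal (e := {a, c}) (by simp), ← abs_neg]
    congr 2; simp [det2]; ring
  have hbc := hT.norm_mul_inner_outNormal (e := {b, c}) (by simp)
  rw [hT.sum_triEdges, hT.hull_eq, integral_fderiv_triangle hT.det_ne hg, hab,
    integral_edgeMeasure (e := {a, c}) (by simp) hT.ne_trd,
    integral_edgeMeasure (e := {b, c}) (by simp) hT.ne_snd, ← segMean, ← segMean]
  linear_combination (-segMean g a c) * hac - (segMean g b c) * hbc

theorem IsTriangle.integral_fderiv {T : Finset E2} {a b c : E2} (hT : IsTriangle T a b c)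
    {g : E2 → ℝ} (hg : ContDiff ℝ 1 g) (w : E2) :
    ∫ x in hull T, fderiv ℝ g x w =
      ∑ e ∈ triEdges T, inner ℝ (outNormal T e) w * ∫ x, g x ∂(edgeMeasure e) := by
  have hw : w = bary a b c (a + w) 0 • (b - a) + bary a b c (a + w) 1 • (c - a) := by
    have := triPt_bary hT.det_ne (a + w)
    rw [triPt, add_assoc] at this
    exact (add_left_cancel this).symm
  have hint (y : E2) : IntegrableOn (fun x => fderiv ℝ g x y) (hull T) :=
    integrableOn_hull_of_continuous
      ((hg.continuous_fderiv one_ne_zero).clm_apply continuous_const) T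
  rw [hw]
  simp only [map_add, map_smul, smul_eq_mul, inner_add_right, real_inner_smul_right]
  rw [integral_add ((hint _).const_mul _) ((hint _).const_mul _), integral_const_mul,
    integral_const_mul, hT.integral_fderiv_side hg, hT.swap.integral_fderiv_side hg,
    Finset.mul_sum, Finset.mul_sum, ← Finset.sum_add_distrib]
  exact Finset.sum_congr rfl fun e _ => by ring

theorem IsTriangle.integral_partialD {T : Finset E2} {a b c : E2} (hT : IsTriangle T a b c)
    {g : E2 → ℝ} (hg : ContDiff ℝ 1 g) (i : Fin 2) :
    ∫ x in hull T, partialD i g x =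
      ∑ e ∈ triEdges T, outNormal T e i * ∫ x, g x ∂(edgeMeasure e) := by
  simpa [partialD, EuclideanSpace.inner_single_right] using
    hT.integral_fderiv hg (EuclideanSpace.single i 1)

/-! ### Polynomials as functions on the plane -/

@[simp] theorem pval_add (p q : Poly2) (x : E2) : pval (p + q) x = pval p x + pval q x :=
  map_add (MvPolynomial.eval _) p q

@[simp] theorem pval_sub (p q : Poly2) (x : E2) : pval (p - q) x = pval p x - pval q x :=
  map_sub (MvPolynomial.eval _) p q

@[simp] theorem pval_mul (p q : Poly2) (x : E2) : pval (p * q) x = pval p x * pval q x :=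
  map_mul (MvPolynomial.eval _) p q

@[simp] theorem pval_C (t : ℝ) (x : E2) : pval (MvPolynomial.C t) x = t :=
  MvPolynomial.eval_C t

@[simp] theorem pval_X (i : Fin 2) (x : E2) : pval (MvPolynomial.X i) x = x i :=
  MvPolynomial.eval_X i

@[simp] theorem pval_zero (x : E2) : pval 0 x = 0 :=
  map_zero (MvPolynomial.eval _)

@[simp] theorem pval_one (x : E2) : pval 1 x = 1 :=
  map_one (MvPolynomial.eval _)

theorem pval_sum {ι : Type*} (s : Finset ι) (p : ι → Poly2) (x : E2) :
    pval (∑ i ∈ s, p i) x = ∑ i ∈ s, pval (p i) x :=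
  map_sum (MvPolynomial.eval _) p s

theorem ext_pval {p q : Poly2} (h : ∀ x, pval p x = pval q x) : p = q :=
  MvPolynomial.funext fun y => h (WithLp.toLp 2 y)

theorem hasFDerivAt_pval (p : Poly2) (x : E2) :
    HasFDerivAt (pval p)
      (∑ i, pval (MvPolynomial.pderiv i p) x • (EuclideanSpace.proj i : E2 →L[ℝ] ℝ)) x := by
  induction p using MvPolynomial.induction_on with
  | C t =>
    have : pval (MvPolynomial.C t) = fun _ => t := funext (pval_C t)
    simpa [this] using hasFDerivAt_const t x
  | add p q hp hq =>
    have : pval (p + q) = fun x => pval p x + pval q x := funext (pval_add p q)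
    rw [this]
    exact (hp.fun_add hq).congr_fderiv (by simp [add_smul, Finset.sum_add_distrib])
  | mul_X p j hp =>
    have : pval (p * MvPolynomial.X j) = fun x => pval p x * x j := by
      funext x; rw [pval_mul, pval_X]
    rw [this]
    refine (hp.fun_mul (EuclideanSpace.proj j : E2 →L[ℝ] ℝ).hasFDerivAt).congr_fderiv ?_
    fin_cases j <;> ext y <;> simp [MvPolynomial.pderiv_X, Fin.sum_univ_two] <;> ring

theorem contDiff_pval (p : Poly2) : ContDiff ℝ ∞ (pval p) := by
  induction p using MvPolynomial.induction_on with
  | C t =>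
    have : pval (MvPolynomial.C t) = fun _ => t := funext (pval_C t)
    rw [this]; exact contDiff_const
  | add p q hp hq =>
    have : pval (p + q) = fun x => pval p x + pval q x := funext (pval_add p q)
    rw [this]; exact hp.add hq
  | mul_X p i hp =>
    have : pval (p * MvPolynomial.X i) = fun x => pval p x * x i := by
      funext x; rw [pval_mul, pval_X]
    rw [this]
    exact hp.mul (EuclideanSpace.proj (𝕜 := ℝ) i : E2 →L[ℝ] ℝ).contDiff

theorem continuous_pval (p : Poly2) : Continuous (pval p) := (contDiff_pval p).continuous

theorem partialD_mul {f g : E2 → ℝ} {x : E2} (hf : DifferentiableAt ℝ f x)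
    (hg : DifferentiableAt ℝ g x) (i : Fin 2) :
    partialD i (fun y => f y * g y) x = partialD i f x * g x + f x * partialD i g x := by
  rw [partialD, fderiv_fun_mul hf hg]
  simp [partialD]; ring

theorem partialD_pval (p : Poly2) (i : Fin 2) (x : E2) :
    partialD i (pval p) x = pval (MvPolynomial.pderiv i p) x := by
  rw [partialD, (hasFDerivAt_pval p x).fderiv]
  fin_cases i <;> simp [Fin.sum_univ_two]

theorem continuous_partialD {φ : E2 → ℝ} (hφ : ContDiff ℝ ∞ φ) (i : Fin 2) :
    Continuous (partialD i φ) :=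
  (hφ.continuous_fderiv (by simp)).clm_apply continuous_const

theorem memLp_partialD {φ : E2 → ℝ} (hφ : IsTest φ) (i : Fin 2) (μ : Measure E2)
    [IsFiniteMeasureOnCompacts μ] : MemLp (partialD i φ) 2 μ :=
  (continuous_partialD hφ.1 i).memLp_of_hasCompactSupport (hφ.2.fderiv_apply (𝕜 := ℝ) _)

theorem continuous_normalDerivP (v : PW) (T e : Finset E2) : Continuous (normalDerivP v T e) :=
  continuous_finsetSum _ fun _ _ => continuous_const.mul (continuous_pval _)

theorem IsTriangle.integral_green {T : Finset E2} {a b c : E2} (hT : IsTriangle T a b c) (v : PW)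
    {φ : E2 → ℝ} (hφ : ContDiff ℝ ∞ φ) :
    ∫ x in hull T, ((∑ i, hessP (v T) i i x) * φ x +
        ∑ i, pval (MvPolynomial.pderiv i (v T)) x * partialD i φ x) =
      ∑ e ∈ triEdges T, ∫ x, normalDerivP v T e x * φ x ∂(edgeMeasure e) := by
  set G : Fin 2 → E2 → ℝ := fun i x => pval (MvPolynomial.pderiv i (v T)) x * φ x with hG
  have hG_smooth (i : Fin 2) : ContDiff ℝ ∞ (G i) := (contDiff_pval _).mul hφ
  have hdiv (x : E2) : (∑ i, hessP (v T) i i x) * φ x +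
      ∑ i, pval (MvPolynomial.pderiv i (v T)) x * partialD i φ x = ∑ i, partialD i (G i) x := by
    rw [Finset.sum_mul, ← Finset.sum_add_distrib]
    refine Finset.sum_congr rfl fun i _ => ?_
    rw [hG, partialD_mul (hasFDerivAt_pval _ x).differentiableAt (hφ.differentiable (by simp) x),
      partialD_pval, hessP]
  simp_rw [hdiv]
  rw [integral_finsetSum _ fun i _ =>
    integrableOn_hull_of_continuous (continuous_partialD (hG_smooth i) i) T]
  simp_rw [fun i => hT.integral_partialD ((hG_smooth i).of_le (by simp)) i]
  rw [Finset.sum_comm]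
  refine Finset.sum_congr rfl fun e he => ?_
  simp_rw [normalDerivP, Finset.sum_mul, mul_assoc]
  rw [integral_finsetSum (f := fun i x => outNormal T e i * G i x) _ fun i _ =>
    integrable_edgeMeasure_of_continuous he (continuous_const.mul (hG_smooth i).continuous)]
  simp_rw [integral_const_mul]

/-! ### Geometry of triangulations -/

namespace IsTriangle

variable {T : Finset E2} {a b c : E2}

theorem mem_interior_hull (hT : IsTriangle T a b c) {s : E2} (h0 : 0 < s 0) (h1 : 0 < s 1)
    (h2 : s 0 + s 1 < 1) : triPt a b c s ∈ interior (hull T) := by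
  refine mem_interior.2 ⟨bary a b c ⁻¹' {t | 0 < t 0 ∧ 0 < t 1 ∧ t 0 + t 1 < 1}, ?_, ?_, ?_⟩
  · rw [hT.hull_eq, convexHull_eq_preimage_refTri hT.det_ne]
    exact fun y hy => ⟨hy.1.le, hy.2.1.le, hy.2.2.le⟩
  · refine IsOpen.preimage (continuous_bary a b c) ?_
    simp only [Set.ofPred_and]
    refine (isOpen_lt ?_ ?_).inter ((isOpen_lt ?_ ?_).inter (isOpen_lt ?_ ?_)) <;> fun_prop
  · rw [Set.mem_preimage, bary_triPt hT.det_ne]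
    exact ⟨h0, h1, h2⟩

theorem mem_interior_or_mem_hull_edge (hT : IsTriangle T a b c) {x : E2} (hx : x ∈ hull T) :
    x ∈ interior (hull T) ∨ ∃ e ∈ triEdges T, x ∈ hull e := by
  classical
  rw [hT.hull_eq, convexHull_eq_image_refTri] at hx
  obtain ⟨s, ⟨h0, h1, h2⟩, rfl⟩ := hx
  have mem_edge {p q : E2} {t : ℝ} (ht : t ∈ Set.Icc (0 : ℝ) 1) :
      p + t • (q - p) ∈ hull ({p, q} : Finset E2) := by
    rw [hull_pair (p := p) (q := q) (by simp), segment_eq_image']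
    exact ⟨t, ht, rfl⟩
  rw [hT.triEdges_eq]
  rcases h0.eq_or_lt with h0 | h0
  · refine Or.inr ⟨{a, c}, by simp, ?_⟩
    convert mem_edge (p := a) (q := c) (t := s 1) ⟨h1, by linarith⟩ using 1
    simp [triPt, ← h0]
  rcases h1.eq_or_lt with h1 | h1
  · refine Or.inr ⟨{a, b}, by simp, ?_⟩
    convert mem_edge (p := a) (q := b) (t := s 0) ⟨h0.le, by linarith⟩ using 1
    simp [triPt, ← h1]
  rcases h2.eq_or_lt with h2 | h2
  · refine Or.inr ⟨{b, c}, by simp, ?_⟩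
    convert mem_edge (p := b) (q := c) (t := s 1) ⟨h1.le, by linarith⟩ using 1
    rw [triPt, eq_sub_of_add_eq h2]
    module
  exact Or.inl (hT.mem_interior_hull h0 h1 h2)

theorem volume_hull_edge {e : Finset E2} (hT : IsTriangle T a b c) (he : e ∈ triEdges T) :
    volume (hull e) = 0 := by
  obtain ⟨o, p, q, h, hpq⟩ := hT.exists_opposite he
  apply measure_mono_null (t := (affineSpan ℝ {p, q} : Set E2))
  · rw [hull, hpq]; exact convexHull_subset_affineSpan _
  · apply Measure.addHaar_affineSubspace
    intro htop
    have ho : o ∈ affineSpan ℝ {p, q} := by rw [htop]; trivial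
    obtain ⟨t, rfl⟩ := mem_affineSpan_pair_iff_exists_lineMap_eq.1 ho
    apply h.det_ne
    simp [det2, AffineMap.lineMap_apply]; ring

end IsTriangle

namespace Mesh

variable {Ω : Set E2} (K : Mesh Ω)

theorem interior_hull_subset (hΩ : interior (closure Ω) = Ω) {T : Finset E2} (hT : T ∈ K.tri) :
    interior (hull T) ⊆ Ω := by
  rw [← hΩ, ← K.cover]
  exact interior_mono (Set.subset_biUnion_of_mem (u := fun T => hull T) hT)

theorem volume_hull_diff (hΩ : interior (closure Ω) = Ω) {T : Finset E2} (hT : T ∈ K.tri) :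
    volume (hull T \ Ω) = 0 := by
  apply measure_mono_null _ ((convex_convexHull ℝ (T : Set E2)).addHaar_frontier volume)
  rintro x ⟨hxT, hxΩ⟩
  exact ⟨subset_closure hxT, fun h => hxΩ (K.interior_hull_subset hΩ hT h)⟩

theorem restrict_hull_le (hΩ : interior (closure Ω) = Ω) {T : Finset E2} (hT : T ∈ K.tri) :
    volume.restrict (hull T) ≤ volume.restrict Ω :=
  Measure.restrict_mono_ae (ae_le_set.2 (K.volume_hull_diff hΩ hT))

theorem volume_hull_inter {T T' : Finset E2} (hT : T ∈ K.tri) (hT' : T' ∈ K.tri) (hne : T ≠ T') :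
    volume (hull T ∩ hull T') = 0 := by
  classical
  obtain ⟨a, b, c, h⟩ := K.exists_isTriangle hT
  have hcard : (T ∩ T').card ≤ 2 := by
    by_contra! h3
    have h3T := K.card_tri T hT
    have h3T' := K.card_tri T' hT'
    have hT_eq : T ∩ T' = T := Finset.eq_of_subset_of_card_le Finset.inter_subset_left (by omega)
    have hT'_eq : T ∩ T' = T' :=
      Finset.eq_of_subset_of_card_le Finset.inter_subset_right (by omega)
    exact hne (hT_eq.symm.trans hT'_eq)
  obtain ⟨e, hsub, heT, he⟩ := Finset.exists_subsuperset_card_eq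
    (Finset.inter_subset_left (s₁ := T) (s₂ := T')) hcard (by rw [K.card_tri T hT]; norm_num)
  rw [K.conforming T hT T' hT', ← Finset.coe_inter]
  exact measure_mono_null (hull_mono hsub)
    (h.volume_hull_edge (Finset.mem_powersetCard.2 ⟨heT, he⟩))

theorem sum_integral_hull (hΩ : interior (closure Ω) = Ω) {g : E2 → ℝ} (hg : IntegrableOn g Ω) :
    ∑ T ∈ K.tri, ∫ x in hull T, g x = ∫ x in Ω, g x := by
  have hcover : ⋃ T : K.tri, hull T.1 = closure Ω := by rw [← K.cover, Set.iUnion_subtype]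
  have hae : (⋃ T : K.tri, hull T.1) =ᵐ[volume] Ω := by
    refine ae_eq_set.2 ⟨?_, ?_⟩
    · rw [Set.iUnion_sdiff]
      exact measure_iUnion_null fun T => K.volume_hull_diff hΩ T.2
    · rw [hcover, Set.sdiff_eq_empty.2 subset_closure, measure_empty]
  rw [← setIntegral_congr_set hae, integral_iUnion_ae, tsum_fintype]
  · exact (Finset.sum_coe_sort K.tri fun T => ∫ x in hull T, g x).symm
  · exact fun T => (measurableSet_hull T.1).nullMeasurableSet
  · exact fun T T' hne => K.volume_hull_inter T.2 T'.2 (fun h => hne (Subtype.ext h))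
  · exact hg.congr_set_ae hae

theorem exists_mem_hull_edge_of_mem_frontier (hΩ : interior (closure Ω) = Ω) {x : E2}
    (hx : x ∈ frontier Ω) : ∃ e, K.IsEdge e ∧ x ∈ hull e := by
  have hcover : x ∈ ⋃ T ∈ K.tri, hull T := K.cover ▸ frontier_subset_closure hx
  obtain ⟨T, hT, hxT⟩ := Set.mem_iUnion₂.1 hcover
  obtain ⟨a, b, c, h⟩ := K.exists_isTriangle hT
  obtain hint | ⟨e, he, hxe⟩ := h.mem_interior_or_mem_hull_edge hxT
  · have hopen : IsOpen Ω := hΩ ▸ isOpen_interior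
    rw [hopen.frontier_eq] at hx
    exact absurd (K.interior_hull_subset hΩ hT hint) hx.2
  · exact ⟨e, ⟨T, hT, he⟩, hxe⟩

open scoped Classical in
theorem hull_inter_hull_of_isEdge {e e' : Finset E2} (he : K.IsEdge e) (he' : K.IsEdge e') :
    hull e ∩ hull e' ⊆ hull (e ∩ e') := by
  obtain ⟨T, hT, heT⟩ := he
  obtain ⟨T', hT', heT'⟩ := he'
  have hs := subset_of_mem_triEdges heT
  have hs' := subset_of_mem_triEdges heT'
  rintro x ⟨hx, hx'⟩
  have hTT' : x ∈ hull (T ∩ T') := by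
    rw [hull, Finset.coe_inter, ← K.conforming T hT T' hT']
    exact ⟨hull_mono hs hx, hull_mono hs' hx'⟩
  have heTT' : x ∈ hull (e ∩ (T ∩ T')) := by
    rw [hull, Finset.coe_inter, (K.indep T hT).convexHull_inter hs Finset.inter_subset_left]
    exact ⟨hx, hTT'⟩
  have hee' : x ∈ hull ((e ∩ (T ∩ T')) ∩ e') := by
    rw [hull, Finset.coe_inter, (K.indep T' hT').convexHull_inter
      (Finset.inter_subset_right.trans Finset.inter_subset_right) hs']
    exact ⟨heTT', hx'⟩
  exact hull_mono (by intro y; simp; tauto) hee'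

theorem disjoint_openEdge_hull {e e' : Finset E2} (he : K.IsEdge e) (he' : K.IsEdge e')
    (hne : e ≠ e') : Disjoint (openEdge e) (hull e') := by
  classical
  rw [Set.disjoint_left]
  rintro x ⟨hx, hxe⟩ hx'
  have hx_inter := K.hull_inter_hull_of_isEdge he he' ⟨hx, hx'⟩
  obtain ⟨T, -, heT⟩ := he
  obtain ⟨T', -, heT'⟩ := he'
  have hc := (Finset.mem_powersetCard.1 heT).2
  have hc' := (Finset.mem_powersetCard.1 heT').2
  have hcard : (e ∩ e').card ≤ 1 := by
    by_contra! h
    have he_eq : e ∩ e' = e := Finset.eq_of_subset_of_card_le Finset.inter_subset_left (by omega)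
    have he'_eq : e ∩ e' = e' := Finset.eq_of_subset_of_card_le Finset.inter_subset_right (by omega)
    exact hne (he_eq.symm.trans he'_eq)
  have hsub : ((e ∩ e' : Finset E2) : Set E2).Subsingleton :=
    Finset.card_le_one_iff_subsingleton.1 hcard
  rw [hull, hsub.convex.convexHull_eq] at hx_inter
  exact hxe (Finset.mem_inter.1 hx_inter).1

theorem exists_ne_edge_mem_hull {e : Finset E2} (he : K.IsEdge e) {x : E2} (hx : x ∈ e) :
    ∃ e', K.IsEdge e' ∧ e' ≠ e ∧ x ∈ hull e' := by
  classical
  obtain ⟨T, hT, heT⟩ := he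
  have hc := (Finset.mem_powersetCard.1 heT).2
  obtain ⟨o, hoT, hoe⟩ : ∃ o ∈ T, o ∉ e :=
    Finset.exists_mem_notMem_of_card_lt_card (by rw [hc, K.card_tri T hT]; norm_num)
  refine ⟨{o, x}, ⟨T, hT, Finset.mem_powersetCard.2 ⟨?_, ?_⟩⟩, ?_, ?_⟩
  · exact Finset.insert_subset hoT (Finset.singleton_subset_iff.2 (subset_of_mem_triEdges heT hx))
  · exact Finset.card_pair fun h => hoe (h ▸ hx)
  · exact fun h => hoe (by rw [← h]; simp)
  · exact subset_convexHull ℝ _ (by simp)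

end Mesh

/-! ### Jumps of the normal derivative -/

theorem IsH2.integrableOn_green {Ω : Set E2} {u : E2 → ℝ} {Du : Fin 2 → E2 → ℝ}
    {D2u : Fin 2 → Fin 2 → E2 → ℝ} (hu : IsH2 Ω u Du D2u) {φ : E2 → ℝ} (hφ : IsTest φ) :
    IntegrableOn (fun x => (∑ i, D2u i i x) * φ x + ∑ i, Du i x * partialD i φ x) Ω := by
  simp_rw [Finset.sum_mul]
  refine Integrable.add ?_ ?_ <;> refine integrable_finsetSum _ fun i _ => ?_
  · exact ((hu.2 i).2 i).1.integrable_mul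
      (hφ.1.continuous.memLp_of_hasCompactSupport (p := 2) hφ.2)
  · exact (hu.1.2 i).1.integrable_mul (memLp_partialD hφ i _)

namespace Mesh

variable {Ω : Set E2} (K : Mesh Ω)

/-- The union of the edges of the mesh other than `e`; the test functions for the jump on `e` are
those whose support avoids it. -/
def otherEdges (e : Finset E2) : Set E2 := ⋃ e' ∈ {e' | K.IsEdge e' ∧ e' ≠ e}, hull e'

variable {e : Finset E2}

theorem disjoint_otherEdges_iff {s : Set E2} :
    Disjoint s (K.otherEdges e) ↔ ∀ e', K.IsEdge e' → e' ≠ e → Disjoint s (hull e') := by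
  simp [otherEdges, Set.disjoint_iUnion_right]

theorem isClosed_otherEdges (e : Finset E2) : IsClosed (K.otherEdges e) := by
  classical
  have hfin : {e' | K.IsEdge e'}.Finite := (K.tri.biUnion triEdges).finite_toSet.subset
    fun e' ⟨T, hT, he'⟩ => Finset.mem_biUnion.2 ⟨T, hT, he'⟩
  exact (hfin.subset fun e' h => h.1).isClosed_biUnion fun e' _ => (isCompact_hull e').isClosed

theorem disjoint_openEdge_otherEdges (he : K.IsEdge e) :
    Disjoint (openEdge e) (K.otherEdges e) :=
  K.disjoint_otherEdges_iff.2 fun _ he' hne => K.disjoint_openEdge_hull he he' hne.symm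

theorem frontier_diff_openEdge_subset (hΩ : interior (closure Ω) = Ω) (he : K.IsEdge e) :
    frontier Ω \ openEdge e ⊆ K.otherEdges e := by
  rintro x ⟨hx, hxe⟩
  obtain ⟨e', he', hxe'⟩ := K.exists_mem_hull_edge_of_mem_frontier hΩ hx
  by_cases hne : e' = e
  · subst hne
    have hvertex : x ∈ e' := by_contra fun h => hxe ⟨hxe', h⟩
    obtain ⟨e'', he'', hne', hxe''⟩ := K.exists_ne_edge_mem_hull he hvertex
    exact Set.mem_biUnion (show e'' ∈ {e'' | _ ∧ _} from ⟨he'', hne'⟩) hxe''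
  · exact Set.mem_biUnion (show e' ∈ {e' | _ ∧ _} from ⟨he', hne⟩) hxe'

theorem frontier_diff_subset_otherEdges (hΩ : interior (closure Ω) = Ω) {Γc : Set E2}
    (he : K.IsEdge e) (hj : openEdge e ⊆ Ω ∨ openEdge e ⊆ Γc) :
    frontier Ω \ Γc ⊆ K.otherEdges e := by
  refine fun x ⟨hx, hxc⟩ => K.frontier_diff_openEdge_subset hΩ he ⟨hx, fun hxe => ?_⟩
  have hopen : IsOpen Ω := hΩ ▸ isOpen_interior
  rw [hopen.frontier_eq] at hx
  exact hj.elim (fun hj => hx.2 (hj hxe)) (fun hj => hxc (hj hxe))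

theorem isNormalJump_ae_unique {Dw : Finset E2 → Fin 2 → E2 → ℝ}
    {D2w : Finset E2 → Fin 2 → Fin 2 → E2 → ℝ} (he : K.IsEdge e) {J J' : E2 → ℝ}
    (h : K.IsNormalJump Dw D2w e J) (h' : K.IsNormalJump Dw D2w e J') :
    J =ᵐ[edgeMeasure e] J' := by
  obtain ⟨T, -, heT⟩ := id he
  have := isFiniteMeasure_edgeMeasure heT
  have hint (φ : E2 → ℝ) (hφ : IsTest φ) {J : E2 → ℝ} (hJ : MemLp J 2 (edgeMeasure e)) :
      Integrable (fun x => J x * φ x) (edgeMeasure e) :=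
    hJ.integrable_mul (memLp_edgeMeasure_of_continuous heT hφ.1.continuous)
  have hzero := (K.isClosed_otherEdges e).isOpen_compl.ae_eq_zero_of_integral_contDiff_smul_eq_zero
    (f := fun x => J x - J' x)
    (((h.1.sub h'.1).integrable (by norm_num)).integrableOn.locallyIntegrableOn) (by
      intro φ hφ hφc hφU
      have hsupp := K.disjoint_otherEdges_iff.1 (Set.subset_compl_iff_disjoint_right.1 hφU)
      simp_rw [smul_eq_mul, mul_comm (φ _), sub_mul]
      rw [integral_sub (hint φ ⟨hφ, hφc⟩ h.1) (hint φ ⟨hφ, hφc⟩ h'.1),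
        ← h.2 φ ⟨hφ, hφc⟩ hsupp, ← h'.2 φ ⟨hφ, hφc⟩ hsupp, sub_self])
  filter_upwards [hzero, ae_mem_openEdge e] with x hx hxe
  exact sub_eq_zero.1 (hx (Set.disjoint_left.1 (K.disjoint_openEdge_otherEdges he) hxe))

theorem continuous_jumpP (v : PW) (e : Finset E2) : Continuous (K.jumpP v e) :=
  continuous_finsetSum _ fun T _ => continuous_normalDerivP v T e

theorem sum_integral_green (v : PW) (he : K.IsEdge e) {φ : E2 → ℝ} (hφ : ContDiff ℝ ∞ φ)
    (hφe : Disjoint (tsupport φ) (K.otherEdges e)) :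
    ∑ T ∈ K.tri, ∫ x in hull T, ((∑ i, hessP (v T) i i x) * φ x +
        ∑ i, pval (MvPolynomial.pderiv i (v T)) x * partialD i φ x) =
      ∫ x, K.jumpP v e x * φ x ∂(edgeMeasure e) := by
  classical
  obtain ⟨T₀, -, heT₀⟩ := he
  have hzero {T e' : Finset E2} (hT : T ∈ K.tri) (he' : e' ∈ triEdges T) (hne : e' ≠ e) :
      ∫ x, normalDerivP v T e' x * φ x ∂(edgeMeasure e') = 0 := by
    refine setIntegral_eq_zero_of_forall_eq_zero fun x hx => ?_
    have hx' : x ∉ tsupport φ := fun hxs =>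
      Set.disjoint_left.1 (K.disjoint_otherEdges_iff.1 hφe e' ⟨T, hT, he'⟩ hne) hxs hx
    rw [image_eq_zero_of_notMem_tsupport hx', mul_zero]
  have hgreen (T : Finset E2) (hT : T ∈ K.tri) :
      ∫ x in hull T, ((∑ i, hessP (v T) i i x) * φ x +
        ∑ i, pval (MvPolynomial.pderiv i (v T)) x * partialD i φ x) =
      if e ∈ triEdges T then ∫ x, normalDerivP v T e x * φ x ∂(edgeMeasure e) else 0 := by
    obtain ⟨a, b, c, h⟩ := K.exists_isTriangle hT
    rw [h.integral_green v hφ]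
    split_ifs with he
    · exact Finset.sum_eq_single_of_mem e he fun e' he' hne => hzero hT he' hne
    · exact Finset.sum_eq_zero fun e' he' => hzero hT he' fun h => he (h ▸ he')
  rw [Finset.sum_congr rfl hgreen, ← Finset.sum_filter, ← integral_finsetSum]
  · simp_rw [jumpP, Finset.sum_mul]
  · exact fun T _ => integrable_edgeMeasure_of_continuous heT₀
      ((continuous_normalDerivP v T e).mul hφ.continuous)

section EnergyFn

variable {Γc : Set E2} {u : E2 → ℝ} {Du : Fin 2 → E2 → ℝ} {D2u : Fin 2 → Fin 2 → E2 → ℝ}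

theorem sum_integral_green_eq_zero (hΩ : interior (closure Ω) = Ω) {φ : E2 → ℝ}
    (hint : IntegrableOn (fun x => (∑ i, D2u i i x) * φ x + ∑ i, Du i x * partialD i φ x) Ω)
    (hn : NormalDerivVanishesOn Ω Γc Du D2u) (he : K.IsEdge e)
    (hj : openEdge e ⊆ Ω ∨ openEdge e ⊆ Γc) (hφ : IsTest φ)
    (hφe : Disjoint (tsupport φ) (K.otherEdges e)) :
    ∑ T ∈ K.tri, ∫ x in hull T, ((∑ i, D2u i i x) * φ x + ∑ i, Du i x * partialD i φ x) = 0 := by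
  rw [K.sum_integral_hull hΩ hint]
  exact hn φ hφ (hφe.mono_right (K.frontier_diff_subset_otherEdges hΩ he hj))

theorem isNormalJump_sub (hΩ : interior (closure Ω) = Ω) (hu : IsH2 Ω u Du D2u)
    (hn : NormalDerivVanishesOn Ω Γc Du D2u) (v : PW) (he : K.IsEdge e)
    (hj : openEdge e ⊆ Ω ∨ openEdge e ⊆ Γc) :
    K.IsNormalJump (fun T i x => Du i x - pval (MvPolynomial.pderiv i (v T)) x)
      (fun T i j x => D2u i j x - hessP (v T) i j x) e (fun x => -K.jumpP v e x) := by
  obtain ⟨T₀, -, heT₀⟩ := id he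
  refine ⟨memLp_edgeMeasure_of_continuous heT₀ (K.continuous_jumpP v e).neg, fun φ hφ hφe => ?_⟩
  have hφe := K.disjoint_otherEdges_iff.2 hφe
  have hint := hu.integrableOn_green hφ
  have hv_cont (T : Finset E2) : Continuous fun x => (∑ i, hessP (v T) i i x) * φ x +
      ∑ i, pval (MvPolynomial.pderiv i (v T)) x * partialD i φ x :=
    ((continuous_finsetSum _ fun i _ => continuous_pval _).mul hφ.1.continuous).add
      (continuous_finsetSum _ fun i _ => (continuous_pval _).mul (continuous_partialD hφ.1 i))
  simp_rw [neg_mul]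
  rw [integral_neg, ← K.sum_integral_green v he hφ.1 hφe, ← zero_sub,
    ← K.sum_integral_green_eq_zero hΩ hint hn he hj hφ hφe, ← Finset.sum_sub_distrib]
  refine Finset.sum_congr rfl fun T hT => ?_
  rw [← integral_sub (Integrable.mono_measure hint (K.restrict_hull_le hΩ hT))
    (integrableOn_hull_of_continuous (hv_cont T) T)]
  congr 1 with x
  simp only [Fin.sum_univ_two]
  ring

theorem integral_normalJump_sq (hΩ : interior (closure Ω) = Ω) (hu : IsH2 Ω u Du D2u)
    (hn : NormalDerivVanishesOn Ω Γc Du D2u) (v : PW) (he : K.IsEdge e)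
    (hj : openEdge e ⊆ Ω ∨ openEdge e ⊆ Γc) :
    ∫ x, (K.normalJump (fun T i x => Du i x - pval (MvPolynomial.pderiv i (v T)) x)
      (fun T i j x => D2u i j x - hessP (v T) i j x) e x) ^ 2 ∂(edgeMeasure e) =
    ∫ x, (K.jumpP v e x) ^ 2 ∂(edgeMeasure e) := by
  have hjump := K.isNormalJump_sub hΩ hu hn v he hj
  have hex : ∃ J, K.IsNormalJump _ _ e J := ⟨_, hjump⟩
  refine integral_congr_ae ?_
  rw [normalJump, dif_pos hex]
  filter_upwards [K.isNormalJump_ae_unique he hex.choose_spec hjump] with x hx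
  rw [hx, neg_sq]

end EnergyFn

/-- The jump part `∑_e h_e⁻¹ ‖⟦∂_n v⟧‖_e²` of the estimator on the triangle `T`. -/
noncomputable def jumpTerm (Γc : Set E2) (v : PW) (T : Finset E2) : ℝ :=
  ∑ e ∈ jumpEdges Ω Γc T, (edgeLen e)⁻¹ * ∫ x, (K.jumpP v e x) ^ 2 ∂(edgeMeasure e)

theorem jumpTerm_nonneg (Γc : Set E2) (v : PW) (T : Finset E2) : 0 ≤ K.jumpTerm Γc v T :=
  Finset.sum_nonneg fun _ _ => mul_nonneg (inv_nonneg.2 Metric.diam_nonneg)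
    (integral_nonneg fun _ => sq_nonneg _)

theorem deflectionError_eq {Γc : Set E2} {u : E2 → ℝ} {Du : Fin 2 → E2 → ℝ}
    {D2u : Fin 2 → Fin 2 → E2 → ℝ} (hΩ : interior (closure Ω) = Ω) (hu : IsH2 Ω u Du D2u)
    (hn : NormalDerivVanishesOn Ω Γc Du D2u) (v : PW) {T : Finset E2} (hT : T ∈ K.tri) :
    K.deflectionError Γc Du D2u v T =
      √((∫ x in hull T, frob (matAt D2u x - matAt (hessP (v T)) x)
        (matAt D2u x - matAt (hessP (v T)) x)) + K.jumpTerm Γc v T) := by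
  classical
  rw [deflectionError, norm2h, jumpTerm]
  congr 2
  refine Finset.sum_congr rfl fun e he => ?_
  obtain ⟨heT, hj⟩ := Finset.mem_filter.1 he
  rw [K.integral_normalJump_sq hΩ hu hn v ⟨T, hT, heT⟩ hj]

end Mesh

/-! ### Affine substitutions in polynomials -/

theorem totalDegree_pderiv_le (p : Poly2) (i : Fin 2) :
    (MvPolynomial.pderiv i p).totalDegree ≤ p.totalDegree := by
  conv_lhs => rw [p.as_sum, map_sum]
  refine (MvPolynomial.totalDegree_finsetSum _ _).trans (Finset.sup_le fun m hm => ?_)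
  rw [MvPolynomial.pderiv_monomial]
  refine (MvPolynomial.totalDegree_monomial_le _ _).trans
    (le_trans ?_ (MvPolynomial.le_totalDegree hm))
  rw [Finsupp.sum_fintype _ _ (fun _ => rfl), Finsupp.sum_fintype _ _ (fun _ => rfl)]
  exact Finset.sum_le_sum fun j _ => by simp

theorem totalDegree_aeval_le {g : Fin 2 → Poly2} (hg : ∀ i, (g i).totalDegree ≤ 1) (p : Poly2) :
    (MvPolynomial.aeval g p).totalDegree ≤ p.totalDegree := by
  conv_lhs => rw [p.as_sum, map_sum]
  refine (MvPolynomial.totalDegree_finsetSum _ _).trans (Finset.sup_le fun m hm => ?_)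
  rw [MvPolynomial.aeval_monomial, MvPolynomial.algebraMap_eq]
  refine le_trans ?_ (MvPolynomial.le_totalDegree hm)
  refine (MvPolynomial.totalDegree_mul _ _).trans ?_
  rw [MvPolynomial.totalDegree_C, zero_add, Finsupp.prod_fintype _ _ (fun _ => pow_zero _),
    Finsupp.sum_fintype _ _ (fun _ => rfl)]
  refine (MvPolynomial.totalDegree_finsetProd _ _).trans (Finset.sum_le_sum fun i _ => ?_)
  refine (MvPolynomial.totalDegree_pow _ _).trans ?_
  exact (Nat.mul_le_mul_left _ (hg i)).trans (by simp)

/-- The polynomial `x ↦ p (t + G x)`, for an affine map `x ↦ t + G x` of the plane. -/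
noncomputable def affineSubst (t : Fin 2 → ℝ) (G : Matrix (Fin 2) (Fin 2) ℝ) :
    Poly2 →ₐ[ℝ] Poly2 :=
  MvPolynomial.aeval fun i =>
    MvPolynomial.C (t i) + ∑ k, MvPolynomial.C (G i k) * MvPolynomial.X k

theorem affineSubst_X (t : Fin 2 → ℝ) (G : Matrix (Fin 2) (Fin 2) ℝ) (i : Fin 2) :
    affineSubst t G (MvPolynomial.X i) =
      MvPolynomial.C (t i) + ∑ k, MvPolynomial.C (G i k) * MvPolynomial.X k :=
  MvPolynomial.aeval_X _ i

theorem pval_affineSubst (t : Fin 2 → ℝ) (G : Matrix (Fin 2) (Fin 2) ℝ) (p : Poly2) (x : E2) :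
    pval (affineSubst t G p) x = pval p (WithLp.toLp 2 fun i => t i + ∑ k, G i k * x k) := by
  induction p using MvPolynomial.induction_on with
  | C u => simp [affineSubst, pval]
  | add p q hp hq => simp only [map_add, pval_add, hp, hq]
  | mul_X p i hp =>
    simp only [map_mul, pval_mul, hp, affineSubst_X, pval_add, pval_sum, pval_C, pval_X]

theorem totalDegree_affineSubst_le (t : Fin 2 → ℝ) (G : Matrix (Fin 2) (Fin 2) ℝ) (p : Poly2) :
    (affineSubst t G p).totalDegree ≤ p.totalDegree := by
  refine totalDegree_aeval_le (fun i => ?_) p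
  refine (MvPolynomial.totalDegree_add _ _).trans (max_le (by simp) ?_)
  refine (MvPolynomial.totalDegree_finsetSum _ _).trans (Finset.sup_le fun k _ => ?_)
  exact (MvPolynomial.totalDegree_mul _ _).trans (by simp)

theorem pderiv_affineSubst (t : Fin 2 → ℝ) (G : Matrix (Fin 2) (Fin 2) ℝ) (p : Poly2)
    (k : Fin 2) :
    MvPolynomial.pderiv k (affineSubst t G p) =
      ∑ i, MvPolynomial.C (G i k) * affineSubst t G (MvPolynomial.pderiv i p) := by
  induction p using MvPolynomial.induction_on with
  | C u => simp [affineSubst]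
  | add p q hp hq => simp only [map_add, hp, hq, mul_add, Finset.sum_add_distrib]
  | mul_X p j hp =>
    have hX : MvPolynomial.pderiv k (affineSubst t G (MvPolynomial.X j)) =
        MvPolynomial.C (G j k) := by
      fin_cases k <;> simp [affineSubst_X, MvPolynomial.pderiv_X]
    rw [map_mul, Derivation.leibniz, hp, hX]
    fin_cases j <;>
      simp [Derivation.leibniz, MvPolynomial.pderiv_X] <;> ring

/-- The gradients (as rows) of the barycentric coordinates `bary a b c`. -/
noncomputable def baryGrad (a b c : E2) : Matrix (Fin 2) (Fin 2) ℝ :=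
  (det2 (b - a) (c - a))⁻¹ • !![(c - a) 1, -(c - a) 0; -(b - a) 1, (b - a) 0]

/-- The polynomial on the triangle `a b c` that corresponds to `q` on the reference triangle. -/
noncomputable def pushPoly (a b c : E2) : Poly2 →ₐ[ℝ] Poly2 :=
  affineSubst (bary a b c 0) (baryGrad a b c)

/-- The polynomial on the reference triangle that corresponds to `p` on the triangle `a b c`. -/
noncomputable def pullPoly (a b c : E2) : Poly2 →ₐ[ℝ] Poly2 :=
  affineSubst a (Matrix.of fun i => ![(b - a) i, (c - a) i])

theorem pval_pushPoly (a b c : E2) (q : Poly2) (x : E2) :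
    pval (pushPoly a b c q) x = pval q (bary a b c x) := by
  rw [pushPoly, pval_affineSubst]
  congr 1
  ext k
  fin_cases k <;> simp [baryGrad, bary, det2] <;> ring

theorem pval_pullPoly (a b c : E2) (p : Poly2) (s : E2) :
    pval (pullPoly a b c p) s = pval p (triPt a b c s) := by
  rw [pullPoly, pval_affineSubst]
  congr 1
  ext k
  simp [triPt]
  ring

theorem pushPoly_pullPoly {a b c : E2} (h : det2 (b - a) (c - a) ≠ 0) (p : Poly2) :
    pushPoly a b c (pullPoly a b c p) = p :=
  ext_pval fun x => by rw [pval_pushPoly, pval_pullPoly, triPt_bary h]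

theorem pderiv_pushPoly (a b c : E2) (q : Poly2) (i : Fin 2) :
    MvPolynomial.pderiv i (pushPoly a b c q) =
      ∑ k, MvPolynomial.C (baryGrad a b c k i) * pushPoly a b c (MvPolynomial.pderiv k q) :=
  pderiv_affineSubst _ _ q i

theorem hessP_pushPoly (a b c : E2) (w : Poly2) (i j : Fin 2) (x : E2) :
    hessP (pushPoly a b c w) i j x = ∑ k, ∑ l, baryGrad a b c k i * baryGrad a b c l j *
      pval (pushPoly a b c (MvPolynomial.pderiv l (MvPolynomial.pderiv k w))) x := by
  simp only [hessP, pderiv_pushPoly, map_sum, MvPolynomial.pderiv_C_mul, pval_sum,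
    pval_mul, pval_C, Finset.mul_sum, mul_assoc]

theorem integral_pushPoly {T : Finset E2} {a b c : E2} (hT : IsTriangle T a b c) (q : Poly2) :
    ∫ x in hull T, pval (pushPoly a b c q) x =
      |det2 (b - a) (c - a)| * ∫ s in refTri, pval q s := by
  simp only [hT.hull_eq, integral_triangle hT.det_ne, pval_pushPoly, bary_triPt hT.det_ne]

/-! ### Bubble functions -/

theorem integrableOn_refTri (q : Poly2) : IntegrableOn (pval q) refTri :=
  (continuous_pval q).continuousOn.integrableOn_compact isCompact_refTri

/-- Integration over the reference triangle, as a linear functional. -/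
noncomputable def refInt : Poly2 →ₗ[ℝ] ℝ where
  toFun q := ∫ s in refTri, pval q s
  map_add' p q := by
    simp only [pval_add]
    exact integral_add (integrableOn_refTri p) (integrableOn_refTri q)
  map_smul' t q := by
    simp only [MvPolynomial.smul_eq_C_mul, pval_mul, pval_C, integral_const_mul, smul_eq_mul,
      RingHom.id_apply]

theorem refInt_apply (q : Poly2) : refInt q = ∫ s in refTri, pval q s := rfl

theorem refInt_mul_self_nonneg (q : Poly2) : 0 ≤ refInt (q * q) :=
  integral_nonneg fun s => (pval_mul q q s).symm ▸ mul_self_nonneg (pval q s)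

/-- The cubic bubble function, which vanishes on the boundary of the reference triangle. -/
noncomputable def refBubble : Poly2 :=
  MvPolynomial.X 0 * MvPolynomial.X 1 * (1 - MvPolynomial.X 0 - MvPolynomial.X 1)

theorem pval_refBubble (s : E2) : pval refBubble s = s 0 * s 1 * (1 - s 0 - s 1) := by
  simp [refBubble]

theorem eq_zero_of_refInt_bubble {q : Poly2}
    (h : refInt (refBubble * q * (refBubble * q)) = 0) : q = 0 := by
  rw [refInt_apply, setIntegral_eq_zero_iff_of_nonneg_ae
    (.of_forall fun s => (pval_mul _ _ s).symm ▸ mul_self_nonneg (pval (refBubble * q) s))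
    (integrableOn_refTri _)] at h
  set V : Set E2 := {s | s 0 ∈ Set.Ioo 0 (1 / 2) ∧ s 1 ∈ Set.Ioo 0 (1 / 2)}
  have hVo : IsOpen V :=
    (isOpen_Ioo.preimage (f := fun s : E2 => s 0) (by fun_prop)).inter
      (isOpen_Ioo.preimage (f := fun s : E2 => s 1) (by fun_prop))
  have hVs : V ⊆ refTri := fun s ⟨h0, h1⟩ => ⟨h0.1.le, h1.1.le, by linarith [h0.2, h1.2]⟩
  have hV0 := Measure.eqOn_open_of_ae_eq (ae_restrict_of_ae_restrict_of_subset hVs h) hVo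
    (continuous_pval _).continuousOn continuousOn_const
  refine MvPolynomial.funext_set (fun _ => Set.Ioo (0 : ℝ) (1 / 2))
    (fun _ => Set.Ioo_infinite (by norm_num)) fun y hy => ?_
  obtain ⟨h0, h1⟩ := And.intro (hy 0 trivial) (hy 1 trivial)
  have hy0 := hV0 (show WithLp.toLp 2 y ∈ V from ⟨h0, h1⟩)
  simp only [pval_mul, pval_refBubble, Pi.zero_apply, mul_self_eq_zero] at hy0
  have hb : y 0 * y 1 * (1 - y 0 - y 1) ≠ 0 :=
    (mul_pos (mul_pos h0.1 h1.1) (by linarith [h0.2, h1.2])).ne'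
  exact ((mul_eq_zero.1 hy0).resolve_left hb).trans (map_zero _).symm

theorem exists_bilinear_le_norm_sq {V : Type*} [NormedAddCommGroup V] [NormedSpace ℝ V]
    [FiniteDimensional ℝ V] (B : V →ₗ[ℝ] V →ₗ[ℝ] ℝ) :
    ∃ C, 0 ≤ C ∧ ∀ x, B x x ≤ C * (‖x‖ * ‖x‖) :=
  ⟨‖B.toContinuousBilinearMap‖, B.toContinuousBilinearMap.opNorm_nonneg, fun x =>
    (le_abs_self _).trans <|
    (B.toContinuousBilinearMap.le_opNorm₂ x x).trans_eq (mul_assoc _ _ _)⟩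

theorem exists_le_of_posDef {V : Type*} [AddCommGroup V] [Module ℝ V] [FiniteDimensional ℝ V]
    (B B' : V →ₗ[ℝ] V →ₗ[ℝ] ℝ) (hs : ∀ x y, B x y = B y x) (h0 : ∀ x, 0 ≤ B x x)
    (hd : ∀ x, B x x = 0 → x = 0) : ∃ C, 0 ≤ C ∧ ∀ x, B' x x ≤ C * B x x := by
  let core : InnerProductSpace.Core ℝ V :=
    { inner := fun x y => B x y
      conj_inner_symm := fun x y => hs y x
      re_inner_nonneg := h0
      add_left := fun x y z => by simp
      smul_left := fun x y r => by simp
      definite := hd }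
  let _ : NormedAddCommGroup V := core.toNormedAddCommGroup
  let _ : InnerProductSpace ℝ V := InnerProductSpace.ofCore core.toCore
  obtain ⟨C, hC0, hC⟩ : ∃ C, 0 ≤ C ∧ ∀ x : V, B' x x ≤ C * (‖x‖ * ‖x‖) :=
    exists_bilinear_le_norm_sq B'
  refine ⟨C, hC0, fun x => (hC x).trans_eq ?_⟩
  rw [← real_inner_self_eq_norm_mul_norm]
  rfl

theorem exists_refInt_le (r : ℕ) (L : Poly2 →ₗ[ℝ] Poly2) : ∃ C : ℝ, 0 ≤ C ∧ ∀ q : Poly2,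
    q.totalDegree ≤ r → refInt (L q * L q) ≤ C * refInt (refBubble * q * (refBubble * q)) := by
  let V := MvPolynomial.restrictTotalDegree (Fin 2) ℝ r
  let form (M : Poly2 →ₗ[ℝ] Poly2) : V →ₗ[ℝ] V →ₗ[ℝ] ℝ :=
    ((LinearMap.mul ℝ Poly2).compl₁₂ (M ∘ₗ V.subtype) (M ∘ₗ V.subtype)).compr₂ refInt
  have form_apply (M : Poly2 →ₗ[ℝ] Poly2) (x y : V) : form M x y = refInt (M x * M y) := rfl
  obtain ⟨C, hC0, hC⟩ := exists_le_of_posDef (form (LinearMap.mulLeft ℝ refBubble)) (form L)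
    (fun x y => by rw [form_apply, form_apply, mul_comm])
    (fun x => refInt_mul_self_nonneg _)
    (fun x hx => Subtype.ext (eq_zero_of_refInt_bubble hx))
  exact ⟨C, hC0, fun q hq => hC ⟨q, (MvPolynomial.mem_restrictTotalDegree _ _ _).2 hq⟩⟩

/-- The product of `p` with the square of the cubic bubble function of the triangle `a b c`, the
test function for the residual `p`. The square makes the gradient vanish on the boundary too. -/
noncomputable def bubbleMul (a b c : E2) (p : Poly2) : Poly2 :=
  pushPoly a b c (refBubble * (refBubble * pullPoly a b c p))

/-- `v` vanishes on the boundary of the triangle `T`. -/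
def VanishesOnEdges (T : Finset E2) (v : Poly2) : Prop :=
  ∀ e ∈ triEdges T, ∀ x ∈ hull e, pval v x = 0

theorem pval_refBubble_bary_eq_zero {T e : Finset E2} {a b c x : E2}
    (hT : IsTriangle T a b c) (he : e ∈ triEdges T) (hx : x ∈ hull e) :
    pval refBubble (bary a b c x) = 0 := by
  classical
  have of_triPt (s : E2) (hs : s 0 * s 1 * (1 - s 0 - s 1) = 0) :
      pval refBubble (bary a b c (triPt a b c s)) = 0 := by
    rw [bary_triPt hT.det_ne, pval_refBubble, hs]
  rw [hT.triEdges_eq] at he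
  simp only [Finset.mem_insert, Finset.mem_singleton] at he
  rcases he with rfl | rfl | rfl
  · rw [hull_pair (p := a) (q := b) (by simp), segment_eq_image'] at hx
    obtain ⟨t, -, rfl⟩ := hx
    convert of_triPt !₂[t, 0] (by simp) using 3
    simp [triPt]
  · rw [hull_pair (p := a) (q := c) (by simp), segment_eq_image'] at hx
    obtain ⟨t, -, rfl⟩ := hx
    convert of_triPt !₂[0, t] (by simp) using 3
    simp [triPt]
  · rw [hull_pair (p := b) (q := c) (by simp), segment_eq_image'] at hx
    obtain ⟨t, -, rfl⟩ := hx
    convert of_triPt !₂[1 - t, t] (by simp) using 3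
    apply ext_E2 <;> simp [triPt] <;> ring

namespace IsTriangle

variable {T : Finset E2} {a b c : E2}

theorem vanishesOnEdges_bubbleMul (hT : IsTriangle T a b c) (p : Poly2) :
    VanishesOnEdges T (bubbleMul a b c p) := fun e he x hx => by
  rw [bubbleMul, pval_pushPoly, pval_mul, pval_refBubble_bary_eq_zero hT he hx, zero_mul]

theorem vanishesOnEdges_pderiv_bubbleMul (hT : IsTriangle T a b c) (p : Poly2) (i : Fin 2) :
    VanishesOnEdges T (MvPolynomial.pderiv i (bubbleMul a b c p)) := fun e he x hx => by
  have h0 := pval_refBubble_bary_eq_zero hT he hx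
  simp [bubbleMul, pderiv_pushPoly, pval_pushPoly, Derivation.leibniz, h0]

theorem integral_pushPoly_sq (hT : IsTriangle T a b c) (q : Poly2) :
    ∫ x in hull T, pval (pushPoly a b c q) x ^ 2 =
      |det2 (b - a) (c - a)| * refInt (q * q) := by
  rw [refInt_apply, ← integral_pushPoly hT]
  simp only [map_mul, pval_mul, sq]

theorem integral_mul_bubbleMul (hT : IsTriangle T a b c) (p : Poly2) :
    ∫ x in hull T, pval p x * pval (bubbleMul a b c p) x = |det2 (b - a) (c - a)| *
      refInt (refBubble * pullPoly a b c p * (refBubble * pullPoly a b c p)) := by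
  rw [refInt_apply, ← integral_pushPoly hT]
  simp only [bubbleMul, map_mul, pval_mul, pushPoly_pullPoly hT.det_ne]
  exact integral_congr_ae (.of_forall fun x => by ring)

theorem integral_mul_bubbleMul_nonneg (hT : IsTriangle T a b c) (p : Poly2) :
    0 ≤ ∫ x in hull T, pval p x * pval (bubbleMul a b c p) x := by
  rw [hT.integral_mul_bubbleMul]
  exact mul_nonneg (abs_nonneg _) (refInt_mul_self_nonneg _)

end IsTriangle

theorem exists_integral_pushPoly_sq_le (r : ℕ) (L : Poly2 →ₗ[ℝ] Poly2) :
    ∃ C : ℝ, 0 ≤ C ∧ ∀ {T : Finset E2} {a b c : E2}, IsTriangle T a b c →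
      ∀ {p : Poly2}, p.totalDegree ≤ r →
        ∫ x in hull T, pval (pushPoly a b c (L (pullPoly a b c p))) x ^ 2 ≤
          C * ∫ x in hull T, pval p x * pval (bubbleMul a b c p) x := by
  obtain ⟨C, hC0, hC⟩ := exists_refInt_le r L
  refine ⟨C, hC0, fun {T a b c} hT p hp => ?_⟩
  rw [hT.integral_pushPoly_sq, hT.integral_mul_bubbleMul, mul_left_comm]
  gcongr
  exact hC _ ((totalDegree_affineSubst_le _ _ p).trans hp)

theorem exists_integral_sq_le_bubbleMul (r : ℕ) :
    ∃ C : ℝ, 0 ≤ C ∧ ∀ {T : Finset E2} {a b c : E2}, IsTriangle T a b c →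
      ∀ {p : Poly2}, p.totalDegree ≤ r →
        ∫ x in hull T, pval p x ^ 2 ≤ C * ∫ x in hull T, pval p x * pval (bubbleMul a b c p) x := by
  obtain ⟨C, hC0, hC⟩ := exists_integral_pushPoly_sq_le r LinearMap.id
  refine ⟨C, hC0, fun {T a b c} hT p hp => ?_⟩
  simpa only [LinearMap.id_apply, pushPoly_pullPoly hT.det_ne] using hC hT hp

theorem exists_integral_bubbleMul_sq_le (r : ℕ) :
    ∃ C : ℝ, 0 ≤ C ∧ ∀ {T : Finset E2} {a b c : E2}, IsTriangle T a b c →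
      ∀ {p : Poly2}, p.totalDegree ≤ r →
        ∫ x in hull T, pval (bubbleMul a b c p) x ^ 2 ≤
          C * ∫ x in hull T, pval p x * pval (bubbleMul a b c p) x :=
  exists_integral_pushPoly_sq_le r
    (LinearMap.mulLeft ℝ refBubble ∘ₗ LinearMap.mulLeft ℝ refBubble)

theorem sq_sum_sum_mul_le {ι κ : Type*} [Fintype ι] [Fintype κ] {M : ℝ} {x : ι → κ → ℝ}
    (hx : ∀ k l, |x k l| ≤ M) (y : ι → κ → ℝ) :
    (∑ k, ∑ l, x k l * y k l) ^ 2 ≤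
      Fintype.card (ι × κ) * M ^ 2 * ∑ k, ∑ l, y k l ^ 2 := by
  simp only [← Fintype.sum_prod_type' fun k l => x k l * y k l,
    ← Fintype.sum_prod_type' fun k l => y k l ^ 2]
  refine sq_sum_le_card_mul_sum_sq.trans ?_
  rw [Finset.card_univ, mul_assoc]
  gcongr
  rw [Finset.mul_sum]
  refine Finset.sum_le_sum fun kl _ => ?_
  rw [mul_pow]
  refine mul_le_mul_of_nonneg_right ?_ (sq_nonneg _)
  exact sq_le_sq' (abs_le.1 (hx _ _)).1 (abs_le.1 (hx _ _)).2

theorem exists_integral_hessP_bubbleMul_sq_le (r : ℕ) :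
    ∃ C : ℝ, 0 ≤ C ∧ ∀ {T : Finset E2} {a b c : E2}, IsTriangle T a b c →
      ∀ {p : Poly2}, p.totalDegree ≤ r → ∀ {γ : ℝ}, (∀ k i, |baryGrad a b c k i| ≤ γ) → ∀ i j,
        ∫ x in hull T, hessP (bubbleMul a b c p) i j x ^ 2 ≤
          C * γ ^ 4 * ∫ x in hull T, pval p x * pval (bubbleMul a b c p) x := by
  let L (k l : Fin 2) : Poly2 →ₗ[ℝ] Poly2 :=
    (MvPolynomial.pderiv l).toLinearMap ∘ₗ (MvPolynomial.pderiv k).toLinearMap ∘ₗ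
      LinearMap.mulLeft ℝ refBubble ∘ₗ LinearMap.mulLeft ℝ refBubble
  choose C hC0 hC using fun k l => exists_integral_pushPoly_sq_le r (L k l)
  refine ⟨4 * ∑ k, ∑ l, C k l,
    mul_nonneg (by norm_num) (Finset.sum_nonneg fun k _ => Finset.sum_nonneg fun l _ => hC0 k l),
    fun {T a b c} hT p hp γ hγ i j => ?_⟩
  let g (k l : Fin 2) (x : E2) : ℝ := pval (pushPoly a b c (L k l (pullPoly a b c p))) x
  have hg (k l : Fin 2) : Continuous (g k l) := continuous_pval _
  have hess_le (x : E2) :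
      hessP (bubbleMul a b c p) i j x ^ 2 ≤ 4 * γ ^ 4 * ∑ k, ∑ l, g k l x ^ 2 := by
    have hG (k l : Fin 2) : |baryGrad a b c k i * baryGrad a b c l j| ≤ γ ^ 2 := by
      rw [abs_mul, sq]
      exact mul_le_mul (hγ k i) (hγ l j) (abs_nonneg _) ((abs_nonneg _).trans (hγ k i))
    rw [bubbleMul, hessP_pushPoly]
    refine (sq_sum_sum_mul_le hG _).trans_eq ?_
    rw [← pow_mul]
    norm_num only [Fintype.card_prod, Fintype.card_fin]
    rfl
  calc ∫ x in hull T, hessP (bubbleMul a b c p) i j x ^ 2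
      ≤ ∫ x in hull T, 4 * γ ^ 4 * ∑ k, ∑ l, g k l x ^ 2 :=
        setIntegral_mono (integrableOn_hull_of_continuous ((continuous_pval _).pow 2) T)
          (integrableOn_hull_of_continuous (by fun_prop) T) hess_le
    _ = 4 * γ ^ 4 * ∑ k, ∑ l, ∫ x in hull T, g k l x ^ 2 := by
        rw [integral_const_mul, integral_finsetSum]
        · exact congrArg _ <| Finset.sum_congr rfl fun k _ => integral_finsetSum _ fun l _ =>
            integrableOn_hull_of_continuous ((hg k l).pow 2) T
        · exact fun k _ => integrableOn_hull_of_continuous (by fun_prop) T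
    _ ≤ 4 * γ ^ 4 * ∑ k, ∑ l, C k l * ∫ x in hull T, pval p x * pval (bubbleMul a b c p) x := by
        gcongr with k _ l _
        exact hC k l hT hp
    _ = _ := by simp only [← Finset.sum_mul]; ring

/-! ### Shape regularity -/

theorem IsTriangle.volume_hull {T : Finset E2} {a b c : E2} (hT : IsTriangle T a b c) :
    (volume (hull T)).toReal = |det2 (b - a) (c - a)| / 2 := by
  have hint : ∫ _ in hull T, (1 : ℝ) = (volume (hull T)).toReal := by simp [Measure.real]
  have hhalf : ∫ t in (0 : ℝ)..1, (1 - t) = 1 / 2 := by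
    rw [intervalIntegral.integral_sub intervalIntegrable_const
      intervalIntegral.intervalIntegrable_id, integral_id]
    norm_num
  rw [← hint, hT.hull_eq, integral_triangle hT.det_ne (fun _ => 1),
    integral_refTri continuous_const]
  simp only [intervalIntegral.integral_const, smul_eq_mul, mul_one, sub_zero, hhalf]
  ring

theorem meshSize_sq (T : Finset E2) : meshSize T ^ 2 = (volume (hull T)).toReal :=
  Real.sq_sqrt ENNReal.toReal_nonneg

theorem IsTriangle.abs_det2 {T : Finset E2} {a b c : E2} (hT : IsTriangle T a b c) :
    |det2 (b - a) (c - a)| = 2 * meshSize T ^ 2 := by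
  rw [meshSize_sq, hT.volume_hull]
  ring

theorem IsTriangle.meshSize_pos {T : Finset E2} {a b c : E2} (hT : IsTriangle T a b c) :
    0 < meshSize T := by
  refine (Real.sqrt_nonneg _).lt_of_ne' fun h => hT.det_ne ?_
  rw [← abs_eq_zero, hT.abs_det2, show meshSize T = 0 from h]
  norm_num

theorem IsTriangle.abs_baryGrad_le {T : Finset E2} {a b c : E2} (hT : IsTriangle T a b c)
    (k i : Fin 2) : |baryGrad a b c k i| ≤ Metric.diam (hull T) / (2 * meshSize T ^ 2) := by
  have side_le {p q : E2} (hp : p ∈ ({a, b, c} : Set E2)) (hq : q ∈ ({a, b, c} : Set E2))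
      (j : Fin 2) : |(p - q) j| ≤ Metric.diam (hull T) := by
    rw [← hT.coe_eq] at hp hq
    refine (PiLp.norm_apply_le (p - q) j).trans ?_
    rw [← dist_eq_norm]
    exact Metric.dist_le_diam_of_mem (isCompact_hull T).isBounded
      (subset_convexHull ℝ _ hp) (subset_convexHull ℝ _ hq)
  have hb := side_le (p := b) (q := a) (by simp) (by simp)
  have hc := side_le (p := c) (q := a) (by simp) (by simp)
  rw [← hT.abs_det2, div_eq_inv_mul]
  fin_cases k <;> fin_cases i <;>
    simp only [baryGrad, Fin.zero_eta, Fin.mk_one, Matrix.smul_apply, Matrix.of_apply,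
      Matrix.cons_val', Matrix.cons_val_zero, Matrix.cons_val_one, Matrix.cons_val_fin_one,
      smul_eq_mul, abs_mul, abs_neg, abs_inv] <;>
    gcongr <;> first | exact hb _ | exact hc _

theorem radius_le_meshSize {T : Finset E2} {z : E2} {R : ℝ} (hR : 0 ≤ R)
    (hz : Metric.closedBall z R ⊆ hull T) : R ≤ meshSize T := by
  refine Real.le_sqrt_of_sq_le ?_
  have hvol := ENNReal.toReal_mono (isCompact_hull T).measure_lt_top.ne
    (measure_mono (μ := volume) hz)
  rw [EuclideanSpace.volume_closedBall_fin_two, ENNReal.toReal_mul, ENNReal.toReal_pow,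
    ENNReal.toReal_ofReal hR, ENNReal.toReal_ofReal Real.pi_pos.le] at hvol
  exact (le_mul_of_one_le_right (sq_nonneg R) (by linarith [Real.pi_gt_three])).trans hvol

theorem Mesh.ShapeRegular.abs_baryGrad_le {Ω : Set E2} {K : Mesh Ω} {κ : ℝ}
    (hκ : K.ShapeRegular κ) {T : Finset E2} (hT : T ∈ K.tri) {a b c : E2}
    (habc : IsTriangle T a b c) (k i : Fin 2) : |baryGrad a b c k i| ≤ κ / meshSize T := by
  obtain ⟨z, ρ, hρ, hz, hdiam⟩ := hκ T hT
  have hh := habc.meshSize_pos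
  have hρh := radius_le_meshSize (half_pos hρ).le hz
  have hκ0 : 0 ≤ κ := nonneg_of_mul_nonneg_left (Metric.diam_nonneg.trans hdiam) hρ
  calc |baryGrad a b c k i| ≤ Metric.diam (hull T) / (2 * meshSize T ^ 2) :=
        habc.abs_baryGrad_le k i
    _ ≤ κ * (2 * meshSize T) / (2 * meshSize T ^ 2) := by
        gcongr
        exact hdiam.trans (by gcongr; linarith)
    _ = κ / meshSize T := by field_simp

/-! ### Zero extensions and integration by parts -/

namespace VanishesOnEdges

variable {T : Finset E2} {a b c : E2} {w : Poly2}

theorem integral_edgeMeasure_eq_zero (hw : VanishesOnEdges T w) {e : Finset E2}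
    (he : e ∈ triEdges T) (g : E2 → ℝ) : ∫ x, pval w x * g x ∂(edgeMeasure e) = 0 :=
  setIntegral_eq_zero_of_forall_eq_zero fun x hx => by rw [hw e he x hx, zero_mul]

theorem integral_partialD_mul (hw : VanishesOnEdges T w) (hT : IsTriangle T a b c) {φ : E2 → ℝ}
    (hφ : ContDiff ℝ ∞ φ) (i : Fin 2) :
    ∫ x in hull T, (pval w x * partialD i φ x + pval (MvPolynomial.pderiv i w) x * φ x) = 0 := by
  have hdiv := hT.integral_partialD (((contDiff_pval w).mul hφ).of_le (by simp)) i
  rw [Finset.sum_eq_zero fun e he => by rw [hw.integral_edgeMeasure_eq_zero he, mul_zero]] at hdiv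
  rw [← hdiv]
  refine integral_congr_ae (.of_forall fun x => ?_)
  simp only [partialD_mul ((contDiff_pval w).differentiable (by simp) x)
    (hφ.differentiable (by simp) x), partialD_pval]
  ring

theorem integral_mul_partialD (hw : VanishesOnEdges T w) (hT : IsTriangle T a b c) {φ : E2 → ℝ}
    (hφ : ContDiff ℝ ∞ φ) (i : Fin 2) :
    ∫ x in hull T, pval w x * partialD i φ x =
      -∫ x in hull T, pval (MvPolynomial.pderiv i w) x * φ x := by
  rw [eq_neg_iff_add_eq_zero, ← hw.integral_partialD_mul hT hφ i]
  exact (integral_add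
    (integrableOn_hull_of_continuous ((continuous_pval _).mul (continuous_partialD hφ i)) T)
    (integrableOn_hull_of_continuous ((continuous_pval _).mul hφ.continuous) T)).symm

theorem integral_mul_pderiv (hw : VanishesOnEdges T w) (hT : IsTriangle T a b c) (p : Poly2)
    (i : Fin 2) :
    ∫ x in hull T, pval p x * pval (MvPolynomial.pderiv i w) x =
      -∫ x in hull T, pval (MvPolynomial.pderiv i p) x * pval w x := by
  have h := hw.integral_mul_partialD hT (contDiff_pval p) i
  simp only [partialD_pval] at h
  simp only [mul_comm (pval p _), mul_comm (pval (MvPolynomial.pderiv i p) _), h, neg_neg]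

end VanishesOnEdges

/-- `v` and its gradient vanish on the boundary of the triangle `T`, so that the zero extension of
`v` outside `T` belongs to `H²`. -/
structure VanishesToFirstOrder (T : Finset E2) (v : Poly2) : Prop where
  val : VanishesOnEdges T v
  grad : ∀ i, VanishesOnEdges T (MvPolynomial.pderiv i v)

theorem IsTriangle.vanishesToFirstOrder_bubbleMul {T : Finset E2} {a b c : E2}
    (hT : IsTriangle T a b c) (p : Poly2) : VanishesToFirstOrder T (bubbleMul a b c p) :=
  ⟨hT.vanishesOnEdges_bubbleMul p, hT.vanishesOnEdges_pderiv_bubbleMul p⟩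

theorem VanishesToFirstOrder.integral_frob_hessP {T : Finset E2} {a b c : E2} {v : Poly2}
    (hv : VanishesToFirstOrder T v) (hT : IsTriangle T a b c) (τ : PWMat) :
    ∫ x in hull T, frob (matP τ T x) (matAt (hessP v) x) =
      ∫ x in hull T, divDivP τ T x * pval v x := by
  have hint (p q : Poly2) : IntegrableOn (fun x => pval p x * pval q x) (hull T) :=
    integrableOn_hull_of_continuous ((continuous_pval p).mul (continuous_pval q)) T
  have integral_sum_sum (p q : Fin 2 → Fin 2 → Poly2) :
      ∫ x in hull T, ∑ i, ∑ j, pval (p i j) x * pval (q i j) x =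
        ∑ i, ∑ j, ∫ x in hull T, pval (p i j) x * pval (q i j) x := by
    rw [integral_finsetSum _ fun i _ => integrable_finsetSum _ fun j _ => hint _ _]
    exact Finset.sum_congr rfl fun i _ => integral_finsetSum _ fun j _ => hint _ _
  simp only [frob, matP, matAt, Matrix.of_apply, divDivP, hessP, Finset.sum_mul]
  rw [integral_sum_sum, integral_sum_sum fun i j => MvPolynomial.pderiv i (.pderiv j (τ T i j))]
  refine Finset.sum_congr rfl fun i _ => Finset.sum_congr rfl fun j _ => ?_
  rw [(hv.grad i).integral_mul_pderiv hT, hv.val.integral_mul_pderiv hT, neg_neg]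

theorem memLp_hull_of_continuous {g : E2 → ℝ} (hg : Continuous g) (T : Finset E2) :
    MemLp g 2 (volume.restrict (hull T)) := by
  have : IsFiniteMeasure (volume.restrict (hull T)) :=
    isFiniteMeasure_restrict.2 (isCompact_hull T).measure_lt_top.ne
  obtain ⟨C, hC⟩ := (isCompact_hull T).exists_bound_of_continuousOn hg.continuousOn
  exact MemLp.of_bound hg.aestronglyMeasurable C
    ((ae_restrict_iff' (measurableSet_hull T)).2 (.of_forall hC))

namespace Mesh

variable {Ω : Set E2} (K : Mesh Ω) {T : Finset E2}

theorem integral_indicator_hull (hΩ : interior (closure Ω) = Ω) (hT : T ∈ K.tri) (g : E2 → ℝ) :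
    ∫ x in Ω, (hull T).indicator g x = ∫ x in hull T, g x := by
  rw [setIntegral_indicator (measurableSet_hull T), Set.inter_comm]
  refine setIntegral_congr_set (ae_eq_set.2 ⟨?_, ?_⟩)
  · rw [Set.sdiff_eq_empty.2 Set.inter_subset_left, measure_empty]
  · rw [Set.sdiff_self_inter, K.volume_hull_diff hΩ hT]

theorem isH1_indicator (hΩ : interior (closure Ω) = Ω) (hT : T ∈ K.tri) {w : Poly2}
    (hw : VanishesOnEdges T w) :
    IsH1 Ω ((hull T).indicator (pval w))
      (fun i => (hull T).indicator (pval (MvPolynomial.pderiv i w))) := by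
  obtain ⟨a, b, c, habc⟩ := K.exists_isTriangle hT
  have hmem (q : Poly2) : MemLp ((hull T).indicator (pval q)) 2 (volume.restrict Ω) := by
    rw [memLp_indicator_iff_restrict (measurableSet_hull T),
      Measure.restrict_restrict (measurableSet_hull T)]
    exact (memLp_hull_of_continuous (continuous_pval q) T).mono_measure
      (Measure.restrict_mono Set.inter_subset_left le_rfl)
  refine ⟨hmem w, fun i => ⟨hmem _, fun φ hφ _ => ?_⟩⟩
  simp only [← Set.indicator_mul_left (hull T) (pval _)]
  rw [K.integral_indicator_hull hΩ hT, K.integral_indicator_hull hΩ hT]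
  exact hw.integral_mul_partialD habc hφ.1 i

theorem isEnergyFn_indicator (hΩ : interior (closure Ω) = Ω) (Γc Γs : Set E2) (hT : T ∈ K.tri)
    {v : Poly2} (hv : VanishesToFirstOrder T v) :
    IsEnergyFn Ω Γc Γs ((hull T).indicator (pval v))
      (fun i => (hull T).indicator (pval (MvPolynomial.pderiv i v)))
      (fun i j => (hull T).indicator (hessP v i j)) := by
  obtain ⟨a, b, c, habc⟩ := K.exists_isTriangle hT
  refine ⟨⟨K.isH1_indicator hΩ hT hv.val, fun i => K.isH1_indicator hΩ hT (hv.grad i)⟩,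
    fun i φ hφ _ => ?_, fun φ hφ _ => ?_⟩
  · simp only [← Set.indicator_mul_left, ← Set.indicator_add]
    rw [K.integral_indicator_hull hΩ hT]
    exact hv.val.integral_partialD_mul habc hφ.1 i
  · have hedge (e : Finset E2) (he : e ∈ triEdges T) :
        ∫ x, normalDerivP (fun _ => v) T e x * φ x ∂(edgeMeasure e) = 0 :=
      setIntegral_eq_zero_of_forall_eq_zero fun x hx => by
        rw [normalDerivP, Finset.sum_eq_zero fun i _ => by rw [hv.grad i e he x hx, mul_zero],
          zero_mul]
    rw [← Finset.sum_eq_zero hedge, ← habc.integral_green (fun _ => v) hφ.1,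
      ← K.integral_indicator_hull hΩ hT]
    congr 1 with x
    by_cases hx : x ∈ hull T <;> simp [hx]

theorem integral_frob_moment_hessP (hΩ : interior (closure Ω) = Ω) {Γc Γs : Set E2}
    {Ey d ν : ℝ} {f u : E2 → ℝ} {Du : Fin 2 → E2 → ℝ} {D2u : Fin 2 → Fin 2 → E2 → ℝ}
    (hu : IsPlateSolution Ω Γc Γs Ey d ν f u Du D2u) (hT : T ∈ K.tri) {v : Poly2}
    (hv : VanishesToFirstOrder T v) :
    ∫ x in hull T, frob (moment Ey d ν (matAt D2u x)) (matAt (hessP v) x) =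
      ∫ x in hull T, f x * pval v x := by
  rw [← K.integral_indicator_hull hΩ hT, ← K.integral_indicator_hull hΩ hT]
  convert hu.2 _ _ _ (K.isEnergyFn_indicator hΩ Γc Γs hT hv) using 3 with x x
  · by_cases hx : x ∈ hull T <;> simp [hx, frob, matAt]
  · exact Set.indicator_mul_right _ _ _

end Mesh

/-! ### `L²` norms -/

section LpNorm

variable {α F : Type*} [MeasurableSpace α] {μ : Measure α} [NormedAddCommGroup F]

theorem lpNorm_two_eq_sqrt {g : α → F} (hg : AEStronglyMeasurable g μ) :
    lpNorm g 2 μ = √(∫ x, ‖g x‖ ^ 2 ∂μ) := by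
  rw [lpNorm_eq_integral_norm_rpow_toReal two_ne_zero ENNReal.ofNat_ne_top hg, Real.sqrt_eq_rpow]
  simp

theorem lpNorm_two_le_of_integral_sq_le {g : α → ℝ} {C : ℝ} (hg : AEStronglyMeasurable g μ)
    (h : ∫ x, g x ^ 2 ∂μ ≤ C) : lpNorm g 2 μ ≤ √C := by
  rw [lpNorm_two_eq_sqrt hg]
  simpa using Real.sqrt_le_sqrt h

theorem integral_inner_le_lpNorm_mul [InnerProductSpace ℝ F] {g k : α → F} (hg : MemLp g 2 μ)
    (hk : MemLp k 2 μ) :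
    ∫ x, inner ℝ (g x) (k x) ∂μ ≤ lpNorm g 2 μ * lpNorm k 2 μ := by
  have hinner : ∫ x, inner ℝ (g x) (k x) ∂μ = inner ℝ (hg.toLp g) (hk.toLp k) := by
    rw [L2.inner_def]
    refine integral_congr_ae ?_
    filter_upwards [hg.coeFn_toLp, hk.coeFn_toLp] with x hgx hkx
    rw [hgx, hkx]
  rw [hinner, ← toReal_eLpNorm hg.1, ← toReal_eLpNorm hk.1, ← Lp.norm_toLp g hg,
    ← Lp.norm_toLp k hk]
  exact real_inner_le_norm _ _

end LpNorm

/-- A `2 × 2` matrix as a vector, so that the Euclidean norm is the Frobenius norm. -/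
noncomputable def frobVec :
    Matrix (Fin 2) (Fin 2) ℝ →ₗ[ℝ] EuclideanSpace ℝ (Fin 2 × Fin 2) where
  toFun A := WithLp.toLp 2 fun k => A k.1 k.2
  map_add' _ _ := rfl
  map_smul' _ _ := rfl

theorem inner_frobVec (A B : Matrix (Fin 2) (Fin 2) ℝ) :
    inner ℝ (frobVec A) (frobVec B) = frob A B := by
  rw [PiLp.inner_apply, Fintype.sum_prod_type]
  exact Finset.sum_congr rfl fun i _ => Finset.sum_congr rfl fun j _ => mul_comm _ _

theorem norm_frobVec_sq (A : Matrix (Fin 2) (Fin 2) ℝ) : ‖frobVec A‖ ^ 2 = frob A A := by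
  rw [← real_inner_self_eq_norm_sq, inner_frobVec]

section FrobVec

variable {μ : Measure E2} {A B : E2 → Matrix (Fin 2) (Fin 2) ℝ}

theorem memLp_frobVec (hA : ∀ i j, MemLp (fun x => A x i j) 2 μ) :
    MemLp (fun x => frobVec (A x)) 2 μ :=
  .of_eval_piLp fun k => hA k.1 k.2

theorem memLp_frobVec_sub (hA : MemLp (fun x => frobVec (A x)) 2 μ)
    (hB : MemLp (fun x => frobVec (B x)) 2 μ) : MemLp (fun x => frobVec (A x - B x)) 2 μ := by
  simp only [map_sub]
  exact MemLp.sub hA hB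

theorem integrable_frob (hA : MemLp (fun x => frobVec (A x)) 2 μ)
    (hB : MemLp (fun x => frobVec (B x)) 2 μ) : Integrable (fun x => frob (A x) (B x)) μ :=
  integrable_finsetSum _ fun i _ => integrable_finsetSum _ fun j _ =>
    (hA.eval_piLp (i, j)).integrable_mul (hB.eval_piLp (i, j))

theorem lpNorm_frobVec (hA : MemLp (fun x => frobVec (A x)) 2 μ) :
    lpNorm (fun x => frobVec (A x)) 2 μ = √(∫ x, frob (A x) (A x) ∂μ) := by
  simp only [lpNorm_two_eq_sqrt hA.1, norm_frobVec_sq]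

theorem lpNorm_frobVec_le (hA : ∀ i j, MemLp (fun x => A x i j) 2 μ) {m : ℝ} (hm : 0 ≤ m)
    (h : ∀ i j, ∫ x, A x i j ^ 2 ∂μ ≤ m ^ 2) : lpNorm (fun x => frobVec (A x)) 2 μ ≤ 2 * m := by
  rw [lpNorm_frobVec (memLp_frobVec hA)]
  refine Real.sqrt_le_iff.2 ⟨by positivity, ?_⟩
  simp only [frob, ← sq]
  calc ∫ x, ∑ i, ∑ j, A x i j ^ 2 ∂μ = ∑ i, ∑ j, ∫ x, A x i j ^ 2 ∂μ := by
        rw [integral_finsetSum _ fun i _ =>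
          integrable_finsetSum _ fun j _ => (hA i j).integrable_sq]
        exact Finset.sum_congr rfl fun i _ => integral_finsetSum _ fun j _ => (hA i j).integrable_sq
    _ ≤ ∑ _i : Fin 2, ∑ _j : Fin 2, m ^ 2 := by gcongr with i _ j _; exact h i j
    _ = (2 * m) ^ 2 := by simp only [Fin.sum_univ_two]; ring

end FrobVec

theorem memLp_frobVec_hessP (v : Poly2) (T : Finset E2) :
    MemLp (fun x => frobVec (matAt (hessP v) x)) 2 (volume.restrict (hull T)) :=
  memLp_frobVec fun _ _ => memLp_hull_of_continuous (continuous_pval _) T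

theorem memLp_frobVec_matP (τ : PWMat) (T : Finset E2) :
    MemLp (fun x => frobVec (matP τ T x)) 2 (volume.restrict (hull T)) :=
  memLp_frobVec fun i j => memLp_hull_of_continuous (continuous_pval (τ T i j)) T

theorem memLp_frobVec_moment {μ : Measure E2} {S : Fin 2 → Fin 2 → E2 → ℝ}
    (hS : ∀ i j, MemLp (S i j) 2 μ) (Ey d ν : ℝ) :
    MemLp (fun x => frobVec (moment Ey d ν (matAt S x))) 2 μ := by
  refine memLp_frobVec fun i j => ?_
  have htrace : MemLp (fun x => (matAt S x).trace) 2 μ := memLp_finsetSum _ fun k _ => hS k k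
  exact (((hS i j).const_mul (1 - ν)).add
    ((htrace.const_mul ν).mul_const ((1 : Matrix (Fin 2) (Fin 2) ℝ) i j))).const_mul _

/-! ### The interior residual -/

/-- A constant with which testing `p` against its own bubble multiple inverts the duality between
`L²` and the weighted norm `α ‖v‖ + β ‖∇²v‖`, for polynomials of degree at most `r`. The bound `γ`
on the barycentric gradients measures the size of the triangle. -/
def IsBubbleConstant (r : ℕ) (C : ℝ) : Prop :=
  ∀ {T : Finset E2} {a b c : E2}, IsTriangle T a b c →
    ∀ {γ : ℝ}, (∀ k i, |baryGrad a b c k i| ≤ γ) →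
    ∀ {p : Poly2}, p.totalDegree ≤ r → ∀ {α β : ℝ}, 0 ≤ α → 0 ≤ β →
      ∫ x in hull T, pval p x * pval (bubbleMul a b c p) x ≤
        α * lpNorm (pval (bubbleMul a b c p)) 2 (volume.restrict (hull T)) +
          β * lpNorm (fun x => frobVec (matAt (hessP (bubbleMul a b c p)) x)) 2
            (volume.restrict (hull T)) →
      lpNorm (pval p) 2 (volume.restrict (hull T)) ≤ C * (α + 2 * γ ^ 2 * β)

theorem exists_isBubbleConstant (r : ℕ) : ∃ C : ℝ, 0 ≤ C ∧ IsBubbleConstant r C := by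
  obtain ⟨C₁, hC₁, h₁⟩ := exists_integral_sq_le_bubbleMul r
  obtain ⟨C₂, hC₂, h₂⟩ := exists_integral_bubbleMul_sq_le r
  obtain ⟨C₃, hC₃, h₃⟩ := exists_integral_hessP_bubbleMul_sq_le r
  refine ⟨C₁ + C₂ + C₃, by positivity, fun {T a b c} hT γ hγ p hp α β hα hβ hle => ?_⟩
  have hN := hT.integral_mul_bubbleMul_nonneg p
  have hmeas (q : Poly2) : AEStronglyMeasurable (pval q) (volume.restrict (hull T)) :=
    (continuous_pval q).aestronglyMeasurable
  replace h₁ := h₁ hT hp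
  replace h₂ := h₂ hT hp
  replace h₃ := h₃ hT hp hγ
  set v := bubbleMul a b c p
  set N := ∫ x in hull T, pval p x * pval v x
  set C := C₁ + C₂ + C₃
  set s := √(C * N)
  have hs : s ^ 2 = C * N := Real.sq_sqrt (by positivity)
  have hp_le : lpNorm (pval p) 2 (volume.restrict (hull T)) ≤ s :=
    lpNorm_two_le_of_integral_sq_le (hmeas p) (h₁.trans (by gcongr; simp only [C]; linarith))
  have hv_le : lpNorm (pval v) 2 (volume.restrict (hull T)) ≤ s :=
    lpNorm_two_le_of_integral_sq_le (hmeas v) (h₂.trans (by gcongr; simp only [C]; linarith))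
  have hhess_le : lpNorm (fun x => frobVec (matAt (hessP v) x)) 2 (volume.restrict (hull T)) ≤
      2 * (γ ^ 2 * s) :=
    lpNorm_frobVec_le (fun _ _ => memLp_hull_of_continuous (continuous_pval _) T) (by positivity)
      fun i j => (h₃ i j).trans <| by
        rw [mul_pow, hs, ← pow_mul, mul_comm C₃, mul_assoc]
        gcongr
        simp only [C]
        linarith
  refine hp_le.trans (le_of_not_gt fun hlt => ?_)
  have hs0 : 0 < s := lt_of_le_of_lt (by positivity) hlt
  refine (mul_lt_mul_of_pos_right hlt hs0).not_ge ?_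
  calc s * s = C * N := by rw [← sq, hs]
    _ ≤ C * (α * s + β * (2 * (γ ^ 2 * s))) := by
        gcongr
        exact hle.trans (by gcongr)
    _ = C * (α + 2 * γ ^ 2 * β) * s := by ring

theorem continuous_divDivP (τ : PWMat) (T : Finset E2) : Continuous (divDivP τ T) :=
  continuous_finsetSum _ fun _ _ => continuous_finsetSum _ fun _ _ => continuous_pval _

theorem exists_pval_eq_sub_divDivP {r : ℕ} {q : Poly2} {τ : PWMat} {T : Finset E2}
    (hq : q.totalDegree ≤ r) (hτ : ∀ i j, (τ T i j).totalDegree ≤ r) :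
    ∃ p : Poly2, p.totalDegree ≤ r ∧ pval p = pval q - divDivP τ T := by
  refine ⟨q - ∑ i, ∑ j, MvPolynomial.pderiv i (MvPolynomial.pderiv j (τ T i j)), ?_, ?_⟩
  · rw [← MvPolynomial.mem_restrictTotalDegree]
    refine Submodule.sub_mem _ ((MvPolynomial.mem_restrictTotalDegree _ _ _).2 hq)
      (Submodule.sum_mem _ fun i _ => Submodule.sum_mem _ fun j _ => ?_)
    rw [MvPolynomial.mem_restrictTotalDegree]
    exact ((totalDegree_pderiv_le _ _).trans (totalDegree_pderiv_le _ _)).trans (hτ i j)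
  · ext x
    simp only [pval_sub, pval_sum, Pi.sub_apply, divDivP]

namespace Mesh

variable {Ω : Set E2} (K : Mesh Ω) {T : Finset E2} {Γc Γs : Set E2} {Ey d ν : ℝ} {f u : E2 → ℝ}
  {Du : Fin 2 → E2 → ℝ} {D2u : Fin 2 → Fin 2 → E2 → ℝ}

theorem memLp_hull (hΩ : interior (closure Ω) = Ω) (hT : T ∈ K.tri) {g : E2 → ℝ}
    (hg : MemLp g 2 (volume.restrict Ω)) : MemLp g 2 (volume.restrict (hull T)) :=
  hg.mono_measure (K.restrict_hull_le hΩ hT)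

theorem memLp_hull_hessian (hΩ : interior (closure Ω) = Ω) (hT : T ∈ K.tri)
    (hu : IsH2 Ω u Du D2u) (i j : Fin 2) : MemLp (D2u i j) 2 (volume.restrict (hull T)) :=
  K.memLp_hull hΩ hT ((hu.2 i).2 j).1

theorem integral_sub_divDivP_mul (hΩ : interior (closure Ω) = Ω)
    (hf : MemLp f 2 (volume.restrict Ω)) (hu : IsPlateSolution Ω Γc Γs Ey d ν f u Du D2u)
    (hT : T ∈ K.tri) (τ : PWMat) (q : Poly2) {v : Poly2} (hv : VanishesToFirstOrder T v) :
    ∫ x in hull T, (pval q x - divDivP τ T x) * pval v x =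
      (∫ x in hull T, (pval q x - f x) * pval v x) +
        ∫ x in hull T, frob (moment Ey d ν (matAt D2u x) - matP τ T x) (matAt (hessP v) x) := by
  obtain ⟨a, b, c, habc⟩ := K.exists_isTriangle hT
  have hvL := memLp_hull_of_continuous (continuous_pval v) T
  have hqL := memLp_hull_of_continuous (continuous_pval q) T
  have hfL := K.memLp_hull hΩ hT hf
  have hdL := memLp_hull_of_continuous (continuous_divDivP τ T) T
  have hfv : Integrable (fun x => f x * pval v x) (volume.restrict (hull T)) :=
    hfL.integrable_mul hvL
  have hqv : Integrable (fun x => pval q x * pval v x) (volume.restrict (hull T)) :=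
    hqL.integrable_mul hvL
  have hdv : Integrable (fun x => divDivP τ T x * pval v x) (volume.restrict (hull T)) :=
    hdL.integrable_mul hvL
  have hhess := memLp_frobVec_hessP v T
  have hmoment := memLp_frobVec_moment (K.memLp_hull_hessian hΩ hT hu.1.1) Ey d ν
  have frob_sub (A B H : Matrix (Fin 2) (Fin 2) ℝ) : frob (A - B) H = frob A H - frob B H := by
    simp only [← inner_frobVec, map_sub, inner_sub_left]
  simp only [frob_sub, sub_mul]
  rw [integral_sub hqv hdv, integral_sub hqv hfv,
    integral_sub (integrable_frob hmoment hhess) (integrable_frob (memLp_frobVec_matP τ T) hhess),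
    K.integral_frob_moment_hessP hΩ hu hT hv, hv.integral_frob_hessP habc]
  ring

theorem momentError_eq (hΩ : interior (closure Ω) = Ω) (hu : IsH2 Ω u Du D2u) (hT : T ∈ K.tri)
    (τ : PWMat) :
    momentError Ey d ν D2u τ T =
      lpNorm (fun x => frobVec (moment Ey d ν (matAt D2u x) - matP τ T x)) 2
        (volume.restrict (hull T)) :=
  (lpNorm_frobVec <| memLp_frobVec_sub (memLp_frobVec_moment (K.memLp_hull_hessian hΩ hT hu) _ _ _)
    (memLp_frobVec_matP τ T)).symm

theorem lpNorm_sub_divDivP_le (hΩ : interior (closure Ω) = Ω) (hf : MemLp f 2 (volume.restrict Ω))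
    (hu : IsPlateSolution Ω Γc Γs Ey d ν f u Du D2u) {κ : ℝ} (hκ : K.ShapeRegular κ)
    (hT : T ∈ K.tri) {r : ℕ} {C : ℝ} (hC : IsBubbleConstant r C) {τ : PWMat}
    (hτ : ∀ i j, (τ T i j).totalDegree ≤ r) {q : Poly2} (hq : q.totalDegree ≤ r) :
    lpNorm (pval q - divDivP τ T) 2 (volume.restrict (hull T)) ≤
      C * (lpNorm (pval q - f) 2 (volume.restrict (hull T)) +
        2 * (κ / meshSize T) ^ 2 * momentError Ey d ν D2u τ T) := by
  obtain ⟨a, b, c, habc⟩ := K.exists_isTriangle hT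
  obtain ⟨p, hp, hpval⟩ := exists_pval_eq_sub_divDivP hq hτ
  have hv := habc.vanishesToFirstOrder_bubbleMul p
  rw [← hpval]
  refine hC habc (hκ.abs_baryGrad_le hT habc) hp lpNorm_nonneg (Real.sqrt_nonneg _) ?_
  simp only [hpval, Pi.sub_apply]
  rw [K.integral_sub_divDivP_mul hΩ hf hu hT τ q hv, K.momentError_eq hΩ hu.1.1 hT]
  set v := bubbleMul a b c p
  have hvL := memLp_hull_of_continuous (continuous_pval v) T
  have hqf : MemLp (pval q - f) 2 (volume.restrict (hull T)) :=
    (memLp_hull_of_continuous (continuous_pval q) T).sub (K.memLp_hull hΩ hT hf)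
  have hS := memLp_frobVec_sub
    (memLp_frobVec_moment (K.memLp_hull_hessian hΩ hT hu.1.1) Ey d ν) (memLp_frobVec_matP τ T)
  simp only [← inner_frobVec]
  refine add_le_add ?_ (integral_inner_le_lpNorm_mul hS (memLp_frobVec_hessP v T))
  simpa [mul_comm] using integral_inner_le_lpNorm_mul hqf hvL

theorem meshSize_sq_mul_residual_le (hΩ : interior (closure Ω) = Ω)
    (hf : MemLp f 2 (volume.restrict Ω)) (hu : IsPlateSolution Ω Γc Γs Ey d ν f u Du D2u)
    {κ : ℝ} (hκ : K.ShapeRegular κ) (hT : T ∈ K.tri) {r : ℕ} {C : ℝ}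
    (hC : IsBubbleConstant r C) {τ : PWMat} (hτ : ∀ i j, (τ T i j).totalDegree ≤ r) {q : Poly2}
    (hq : q.totalDegree ≤ r) :
    meshSize T ^ 2 * √(∫ x in hull T, (f x - divDivP τ T x) ^ 2) ≤
      2 * C * κ ^ 2 * momentError Ey d ν D2u τ T +
        (1 + C) * (meshSize T ^ 2 * √(∫ x in hull T, (f x - pval q x) ^ 2)) := by
  obtain ⟨a, b, c, habc⟩ := K.exists_isTriangle hT
  have hqL := memLp_hull_of_continuous (continuous_pval q) T
  have hdL := memLp_hull_of_continuous (continuous_divDivP τ T) T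
  have hfL := K.memLp_hull hΩ hT hf
  have sqrt_eq {g : E2 → ℝ} (hg : MemLp g 2 (volume.restrict (hull T))) :
      √(∫ x in hull T, (f x - g x) ^ 2) = lpNorm (f - g) 2 (volume.restrict (hull T)) := by
    simpa using (lpNorm_two_eq_sqrt (hfL.sub hg).1).symm
  have hh := habc.meshSize_pos.ne'
  rw [sqrt_eq hdL, sqrt_eq hqL]
  calc meshSize T ^ 2 * lpNorm (f - divDivP τ T) 2 (volume.restrict (hull T))
      ≤ meshSize T ^ 2 * (lpNorm (f - pval q) 2 (volume.restrict (hull T)) +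
          lpNorm (pval q - divDivP τ T) 2 (volume.restrict (hull T))) := by
        gcongr
        exact lpNorm_sub_le_lpNorm_sub_add_lpNorm_sub hfL hqL one_le_two
    _ ≤ meshSize T ^ 2 * (lpNorm (f - pval q) 2 (volume.restrict (hull T)) +
          C * (lpNorm (pval q - f) 2 (volume.restrict (hull T)) +
            2 * (κ / meshSize T) ^ 2 * momentError Ey d ν D2u τ T)) := by
        gcongr
        exact K.lpNorm_sub_divDivP_le hΩ hf hu hκ hT hC hτ hq
    _ = _ := by
        rw [lpNorm_sub_comm (pval q)]
        field_simp
        ring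

end Mesh

/-! ### The consistency residual and local efficiency -/

theorem momentInv_sub (Ey d ν : ℝ) (A B : Matrix (Fin 2) (Fin 2) ℝ) :
    momentInv Ey d ν (A - B) = momentInv Ey d ν A - momentInv Ey d ν B := by
  simp only [momentInv, Matrix.trace_sub, mul_sub, sub_smul, smul_sub]
  abel

theorem frob_momentInv_self (Ey d ν : ℝ) (A : Matrix (Fin 2) (Fin 2) ℝ) :
    frob (momentInv Ey d ν A) (momentInv Ey d ν A) =
      (12 / (Ey * d ^ 3)) ^ 2 * ((1 + ν) ^ 2 * frob A A - 2 * ν * A.trace ^ 2) := by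
  simp only [frob, momentInv, Fin.sum_univ_two, Matrix.trace, Matrix.diag_apply, Matrix.smul_apply,
    Matrix.sub_apply, Matrix.one_apply_eq, Matrix.one_apply_ne zero_ne_one,
    Matrix.one_apply_ne one_ne_zero, smul_eq_mul]
  ring

theorem norm_frobVec_momentInv_le {Ey d ν : ℝ} (hEy : 0 < Ey) (hd : 0 < d) (h0 : 0 ≤ ν)
    (h1 : ν < 1 / 2) (A : Matrix (Fin 2) (Fin 2) ℝ) :
    ‖frobVec (momentInv Ey d ν A)‖ ≤ 18 / (Ey * d ^ 3) * ‖frobVec A‖ := by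
  refine le_of_sq_le_sq ?_ (by positivity)
  rw [mul_pow, norm_frobVec_sq, norm_frobVec_sq, frob_momentInv_self]
  have hA : 0 ≤ frob A A := norm_frobVec_sq A ▸ sq_nonneg _
  calc (12 / (Ey * d ^ 3)) ^ 2 * ((1 + ν) ^ 2 * frob A A - 2 * ν * A.trace ^ 2)
      ≤ (12 / (Ey * d ^ 3)) ^ 2 * ((3 / 2) ^ 2 * frob A A) := by
        gcongr
        refine (sub_le_self _ (by positivity)).trans ?_
        gcongr
        linarith
    _ = (18 / (Ey * d ^ 3)) ^ 2 * frob A A := by ring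

theorem memLp_frobVec_momentInv {μ : Measure E2} {A : E2 → Matrix (Fin 2) (Fin 2) ℝ}
    (hA : MemLp (fun x => frobVec (A x)) 2 μ) (Ey d ν : ℝ) :
    MemLp (fun x => frobVec (momentInv Ey d ν (A x))) 2 μ := by
  refine memLp_frobVec fun i j => ?_
  have hentry (i j : Fin 2) : MemLp (fun x => A x i j) 2 μ := hA.eval_piLp (i, j)
  have htrace : MemLp (fun x => (A x).trace) 2 μ := memLp_finsetSum _ fun k _ => hentry k k
  exact (((hentry i j).const_mul (1 + ν)).sub
    ((htrace.const_mul ν).mul_const ((1 : Matrix (Fin 2) (Fin 2) ℝ) i j))).const_mul _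

theorem lpNorm_momentInv_sub_le {Ey d ν : ℝ} (hEy : 0 < Ey) (hd : 0 < d) (h0 : 0 ≤ ν)
    (h1 : ν < 1 / 2) {μ : Measure E2} {H S G : E2 → Matrix (Fin 2) (Fin 2) ℝ}
    (hS : MemLp (fun x => frobVec (moment Ey d ν (H x) - S x)) 2 μ)
    (hG : MemLp (fun x => frobVec (H x - G x)) 2 μ) :
    lpNorm (fun x => frobVec (momentInv Ey d ν (S x) - G x)) 2 μ ≤
      lpNorm (fun x => frobVec (H x - G x)) 2 μ +
        18 / (Ey * d ^ 3) * lpNorm (fun x => frobVec (moment Ey d ν (H x) - S x)) 2 μ := by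
  have hsplit : (fun x => frobVec (momentInv Ey d ν (S x) - G x)) =
      (fun x => frobVec (H x - G x)) -
        fun x => frobVec (momentInv Ey d ν (moment Ey d ν (H x) - S x)) := by
    funext x
    rw [Pi.sub_apply, ← map_sub, momentInv_sub, (moment_momentInv hEy hd h0 h1 _).2]
    congr 1
    abel
  have hbound : lpNorm (fun x => frobVec (momentInv Ey d ν (moment Ey d ν (H x) - S x))) 2 μ ≤
      lpNorm (fun x => 18 / (Ey * d ^ 3) * ‖frobVec (moment Ey d ν (H x) - S x)‖) 2 μ :=
    lpNorm_mono_real (hS.norm.const_mul _) fun x => norm_frobVec_momentInv_le hEy hd h0 h1 _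
  have hscale := lpNorm_const_smul (p := 2) (18 / (Ey * d ^ 3))
    (fun x => ‖frobVec (moment Ey d ν (H x) - S x)‖) μ
  rw [lpNorm_norm hS.1, coe_nnnorm, Real.norm_of_nonneg (by positivity)] at hscale
  rw [hsplit]
  exact (lpNorm_sub_le hG one_le_two).trans (add_le_add_right (hbound.trans hscale.le) _)

theorem sqrt_add_le_add_sqrt {a b : ℝ} (ha : 0 ≤ a) (hb : 0 ≤ b) : √(a + b) ≤ √a + √b := by
  refine Real.sqrt_le_iff.2 ⟨by positivity, ?_⟩
  rw [add_sq, Real.sq_sqrt ha, Real.sq_sqrt hb]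
  have := mul_nonneg (Real.sqrt_nonneg a) (Real.sqrt_nonneg b)
  linarith

namespace Mesh

variable {Ω : Set E2} (K : Mesh Ω) {T : Finset E2} {Γc Γs : Set E2} {Ey d ν : ℝ} {f u : E2 → ℝ}
  {Du : Fin 2 → E2 → ℝ} {D2u : Fin 2 → Fin 2 → E2 → ℝ}

theorem estimator_le (Γc : Set E2) (Ey d ν : ℝ) (f : E2 → ℝ) (σh : PWMat) (v : PW)
    (T : Finset E2) :
    K.estimator Γc Ey d ν f σh v T ≤
      lpNorm (fun x => frobVec (momentInv Ey d ν (matP σh T x) - matAt (hessP (v T)) x)) 2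
          (volume.restrict (hull T)) +
        meshSize T ^ 2 * √(∫ x in hull T, (f x - divDivP σh T x) ^ 2) +
          √(K.jumpTerm Γc v T) := by
  have hM := memLp_frobVec_sub (memLp_frobVec_momentInv (memLp_frobVec_matP σh T) Ey d ν)
    (memLp_frobVec_hessP (v T) T)
  have hcons : 0 ≤ ∫ x in hull T, frob (momentInv Ey d ν (matP σh T x) - matAt (hessP (v T)) x)
      (momentInv Ey d ν (matP σh T x) - matAt (hessP (v T)) x) :=
    integral_nonneg fun x => norm_frobVec_sq (_ - _) ▸ sq_nonneg _
  have hres : 0 ≤ meshSize T ^ 4 * ∫ x in hull T, (f x - divDivP σh T x) ^ 2 := by positivity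
  have hscale : √(meshSize T ^ 4 * ∫ x in hull T, (f x - divDivP σh T x) ^ 2) =
      meshSize T ^ 2 * √(∫ x in hull T, (f x - divDivP σh T x) ^ 2) := by
    rw [Real.sqrt_mul (by positivity), show meshSize T ^ 4 = (meshSize T ^ 2) ^ 2 by ring,
      Real.sqrt_sq (by positivity)]
  rw [lpNorm_frobVec hM, ← hscale]
  exact (sqrt_add_le_add_sqrt (add_nonneg hcons hres) (K.jumpTerm_nonneg Γc v T)).trans
    (add_le_add_left (sqrt_add_le_add_sqrt hcons hres) _)

theorem sqrt_jumpTerm_le_deflectionError (hΩ : interior (closure Ω) = Ω) (hu : IsH2 Ω u Du D2u)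
    (hn : NormalDerivVanishesOn Ω Γc Du D2u) (v : PW) (hT : T ∈ K.tri) :
    √(K.jumpTerm Γc v T) ≤ K.deflectionError Γc Du D2u v T := by
  rw [K.deflectionError_eq hΩ hu hn v hT]
  exact Real.sqrt_le_sqrt <| le_add_of_nonneg_left <|
    integral_nonneg fun x => norm_frobVec_sq (_ - _) ▸ sq_nonneg _

theorem lpNorm_hessian_sub_le_deflectionError (hΩ : interior (closure Ω) = Ω)
    (hu : IsH2 Ω u Du D2u) (hn : NormalDerivVanishesOn Ω Γc Du D2u) (v : PW) (hT : T ∈ K.tri) :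
    lpNorm (fun x => frobVec (matAt D2u x - matAt (hessP (v T)) x)) 2
      (volume.restrict (hull T)) ≤ K.deflectionError Γc Du D2u v T := by
  have hD2u : MemLp (fun x => frobVec (matAt D2u x)) 2 (volume.restrict (hull T)) :=
    memLp_frobVec (K.memLp_hull_hessian hΩ hT hu)
  rw [K.deflectionError_eq hΩ hu hn v hT,
    lpNorm_frobVec (memLp_frobVec_sub hD2u (memLp_frobVec_hessP (v T) T))]
  exact Real.sqrt_le_sqrt (le_add_of_nonneg_right (K.jumpTerm_nonneg Γc v T))

theorem lpNorm_momentInv_sub_hessP_le (hΩ : interior (closure Ω) = Ω) (hEy : 0 < Ey) (hd : 0 < d)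
    (h0 : 0 ≤ ν) (h1 : ν < 1 / 2) (hu : IsH2 Ω u Du D2u)
    (hn : NormalDerivVanishesOn Ω Γc Du D2u) (σh : PWMat) (v : PW) (hT : T ∈ K.tri) :
    lpNorm (fun x => frobVec (momentInv Ey d ν (matP σh T x) - matAt (hessP (v T)) x)) 2
      (volume.restrict (hull T)) ≤
      K.deflectionError Γc Du D2u v T + 18 / (Ey * d ^ 3) * momentError Ey d ν D2u σh T := by
  have hD2u := K.memLp_hull_hessian hΩ hT hu
  rw [K.momentError_eq hΩ hu hT]
  exact (lpNorm_momentInv_sub_le hEy hd h0 h1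
    (memLp_frobVec_sub (memLp_frobVec_moment hD2u Ey d ν) (memLp_frobVec_matP σh T))
    (memLp_frobVec_sub (memLp_frobVec hD2u) (memLp_frobVec_hessP (v T) T))).trans
    (add_le_add_left (K.lpNorm_hessian_sub_le_deflectionError hΩ hu hn v hT) _)

end Mesh

theorem theorem3p3_general {Ey d : ℝ} (hEy : 0 < Ey) (hd : 0 < d) (r : ℕ) (κ : ℝ) :
    ∃ C : ℝ, 0 < C ∧ ∀ {Ω Γc Γs : Set E2} {ν : ℝ} {f u : E2 → ℝ} {Du : Fin 2 → E2 → ℝ}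
      {D2u : Fin 2 → Fin 2 → E2 → ℝ} (K : Mesh Ω), interior (closure Ω) = Ω →
      0 ≤ ν → ν < 1 / 2 → MemLp f 2 (volume.restrict Ω) →
      IsPlateSolution Ω Γc Γs Ey d ν f u Du D2u → K.ShapeRegular κ →
      ∀ (σh : PWMat) (v : PW) (q : Poly2), ∀ T ∈ K.tri,
        (∀ i j, (σh T i j).totalDegree ≤ r) → q.totalDegree ≤ r →
        K.estimator Γc Ey d ν f σh v T ≤
          C * (momentError Ey d ν D2u σh T + K.deflectionError Γc Du D2u v T +
            meshSize T ^ 2 * √(∫ x in hull T, (f x - pval q x) ^ 2)) := by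
  obtain ⟨B, hB, hbubble⟩ := exists_isBubbleConstant r
  refine ⟨18 / (Ey * d ^ 3) + 2 * B * κ ^ 2 + (1 + B) + 2, by positivity, ?_⟩
  intro Ω Γc Γs ν f u Du D2u K hΩ h0 h1 hf hu hκ σh v q T hT hσ hq
  have hH2 := hu.1.1
  have hn := hu.1.2.2
  have hcons := K.lpNorm_momentInv_sub_hessP_le hΩ hEy hd h0 h1 hH2 hn σh v hT
  have hres := K.meshSize_sq_mul_residual_le hΩ hf hu hκ hT hbubble hσ hq
  have hjump := K.sqrt_jumpTerm_le_deflectionError hΩ hH2 hn v hT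
  have hsum := K.estimator_le Γc Ey d ν f σh v T
  set m := momentError Ey d ν D2u σh T
  set t := K.deflectionError Γc Du D2u v T
  set o := meshSize T ^ 2 * √(∫ x in hull T, (f x - pval q x) ^ 2)
  have hm : 0 ≤ m := Real.sqrt_nonneg _
  have ht : 0 ≤ t := Real.sqrt_nonneg _
  have ho : 0 ≤ o := by positivity
  calc K.estimator Γc Ey d ν f σh v T
      ≤ (18 / (Ey * d ^ 3) + 2 * B * κ ^ 2) * m + 2 * t + (1 + B) * o := by linarith
    _ ≤ _ := by
      have hc : 0 ≤ 18 / (Ey * d ^ 3) + 2 * B * κ ^ 2 := by positivity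
      nlinarith [mul_nonneg hc ht, mul_nonneg hc ho, mul_nonneg hB hm, mul_nonneg hB ht]

theorem theorem3p3 (Ω : Set E2) (hΩ : IsPlateDomain Ω) (Ey d : ℝ) (hEy : 0 < Ey) (hd : 0 < d)
    (r : ℕ) (hr : 1 ≤ r) (κ : ℝ) :
    ∃ C : ℝ, 0 < C ∧
      ∀ (ν : ℝ), 0 ≤ ν → ν < 1 / 2 →
      ∀ (Γc Γs Γf : Set E2), IsBoundarySplitting Ω Γc Γs Γf →
      ∀ (f : E2 → ℝ), MemLp f 2 (volume.restrict Ω) →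
      ∀ (u : E2 → ℝ) (Du : Fin 2 → E2 → ℝ) (D2u : Fin 2 → Fin 2 → E2 → ℝ),
        IsPlateSolution Ω Γc Γs Ey d ν f u Du D2u →
      ∀ (K : Mesh Ω), K.Resolves Γc Γs Γf → K.ShapeRegular κ →
      ∀ (σh : PWMat) (uh wh : PW),
        K.IsHHJSolution Γc Γs Γf Ey d ν r f σh uh →
        K.IsCorrection Γc Γs Ey d ν r σh uh wh →
      ∀ (Qf : PW), K.IsL2Projection r f Qf →
      ∀ T ∈ K.tri,
        K.estimator Γc Ey d ν f σh (uh + wh) T ≤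
          C * (momentError Ey d ν D2u σh T +
            K.deflectionError Γc Du D2u (uh + wh) T +
            meshSize T ^ 2 * Real.sqrt (∫ x in hull T, (f x - pval (Qf T) x) ^ 2)) := by
  obtain ⟨C, hC, h⟩ := theorem3p3_general hEy hd r κ
  exact ⟨C, hC, fun ν h0 h1 Γc Γs Γf _ f hf u Du D2u hu K _ hκ σh uh wh hsol _ Qf hQ T hT =>
    h K hΩ.interior_closure h0 h1 hf hu hκ σh (uh + wh) (Qf T) T hT
      (fun i j => (hsol.1.1 T hT i j).2.trans (Nat.sub_le r 1)) (hQ T hT).1⟩
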